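/- Let $N\ge 2$, let $(r_{ab})_{1\le a,b\le N-1}$ be a symmetric positive-definite real matrix, and let $-2<g<2$. Put $h=\sqrt{1-g^2/4}$ and $G=g/h$. For $R=(R^1,\dots,R^{N-1},Z)\in\mathbb R^N$ (with $Z=R^N$) put $q=\sqrt{r_{ab}R^aR^b}$, $B=Z^2+gqZ+q^2$, $A=Z+\tfrac12 gq$, and let $$K(R)=\sqrt{B}\;e^{\frac12 G\Phi},\qquad \Phi=\arctan\frac{A}{hq}\ \ (q>0),\qquad \Phi=\pm\frac{\pi}{2}\ \ (q=0,\ \pm Z>0),\qquad K(0)=0,$$ be the Finsleroid metric function. Let $D_g=\{R: q\neq 0\}$ if $g\ne0$ and $D_0=\mathbb R^N\setminus\{0\}$. On $D_g$ the function $K$ is smooth and positive, and the tensor $g_{pq}=\frac12\,\partial^2K^2/\partial R^p\partial R^q$ is positive definite. Put there $R_p=\frac12\,\partial K^2/\partial R^p$, $h_{pq}=g_{pq}-R_pR_q/K^2$, $C_{pqr}=\frac12\,\partial g_{pq}/\partial R^r$ and $C_p{}^t{}_s=g^{tu}C_{pus}$, where $(g^{tu})$ is the inverse matrix of $(g_{tu})$.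 (1) At every point of $D_g$ the curvature tensor $S_{pqrs}=C_{tqr}C_p{}^t{}_s-C_{tqs}C_p{}^t{}_r$ satisfies $$S_{pqrs}=S^*\,(h_{pr}h_{qs}-h_{ps}h_{qr})/K^2,\qquad S^*=-\tfrac14 g^2 .$$ (2) The Finsleroid indicatrix $\mathcal I=\{R: K(R)=1\}$, with the Riemannian metric induced by $g_{pq}$, is a space of constant positive curvature $h^2=1-\frac14g^2>0$, in the following sense. For every smooth immersion $\varphi$ of an open set $U\subset\mathbb R^{N-1}$ into $\mathcal I\cap D_g$, the metric $\gamma_{ij}=g_{pq}(\varphi)\,\partial_i\varphi^p\,\partial_j\varphi^q$ on $U$ has Riemann tensor $$R_{ijkl}=h^2(\gamma_{ik}\gamma_{jl}-\gamma_{il}\gamma_{jk})$$ (with the sign convention in which round spheres have positive curvature). Moreover every point of $\mathcal I$, including its two points on the axis $q=0$, lies in the domain of a chart of the topological space $\mathcal I$ whose coordinate domain $U\subset\mathbb R^{N-1}$ carries a smooth Riemannian metric $\gamma$ such that $R_{ijkl}=h^2(\gamma_{ik}\gamma_{jl}-\gamma_{il}\gamma_{jk})$ on all of $U$ and such that, over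 $\mathcal I\cap D_g$, the inverse of the chart is a smooth immersion and $\gamma$ is the metric induced by $g_{pq}$. -/

import Mathlib

open scoped ContDiff

namespace Finsleroid

noncomputable section

/-! ### Coordinate calculus -/

/-- The partial derivative of `f` in the `i`-th coordinate direction, at `x`. -/
def pd {ι : Type} [Fintype ι] [DecidableEq ι] (i : ι) (f : (ι → ℝ) → ℝ) (x : ι → ℝ) : ℝ :=
  fderiv ℝ f x (Pi.single i 1)

/-- The Christoffel symbols `Γ^i_{jk}` of a metric `γ` given in coordinates. -/
def christoffel {m : ℕ} (γ : (Fin m → ℝ) → Matrix (Fin m) (Fin m) ℝ)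
    (i j k : Fin m) (u : Fin m → ℝ) : ℝ :=
  (1 / 2) * ∑ l, (γ u)⁻¹ i l *
    (pd j (fun v => γ v l k) u + pd k (fun v => γ v l j) u - pd l (fun v => γ v j k) u)

/-- The Riemann tensor
`R^i_{jkl} = ∂_k Γ^i_{lj} - ∂_l Γ^i_{kj} + Γ^i_{km} Γ^m_{lj} - Γ^i_{lm} Γ^m_{kj}`. -/
def riemannUp {m : ℕ} (γ : (Fin m → ℝ) → Matrix (Fin m) (Fin m) ℝ)
    (i j k l : Fin m) (u : Fin m → ℝ) : ℝ :=
  pd k (christoffel γ i l j) u - pd l (christoffel γ i k j) u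
    + ∑ s, (christoffel γ i k s u * christoffel γ s l j u
      - christoffel γ i l s u * christoffel γ s k j u)

/-- The Riemann tensor with lowered first index, `R_{ijkl} = γ_{is} R^s_{jkl}`. -/
def riemann {m : ℕ} (γ : (Fin m → ℝ) → Matrix (Fin m) (Fin m) ℝ)
    (i j k l : Fin m) (u : Fin m → ℝ) : ℝ :=
  ∑ s, γ u i s * riemannUp γ s j k l u

/-- The metric `γ` has constant curvature `κ` on `U`:
`R_{ijkl} = κ (γ_{ik} γ_{jl} - γ_{il} γ_{jk})`. -/
def HasConstantCurvatureOn {m : ℕ} (γ : (Fin m → ℝ) → Matrix (Fin m) (Fin m) ℝ) (κ : ℝ)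
    (U : Set (Fin m → ℝ)) : Prop :=
  ∀ u ∈ U, ∀ i j k l : Fin m,
    riemann γ i j k l u = κ * (γ u i k * γ u j l - γ u i l * γ u j k)

/-! ### The Finsleroid metric function

The space is `V_N` with `N = n + 1`; a vector is `R = (R^1, …, R^n, Z)`, the distinguished
coordinate `Z = R^N` being the last one; `r` is the matrix of the Euclidean metric on the
first `n` coordinates and `g` the characteristic parameter. -/

/-- `h = √(1 - g²/4)`. -/
def hPar (g : ℝ) : ℝ := Real.sqrt (1 - g ^ 2 / 4)

/-- `G = g / h`. -/
def GPar (g : ℝ) : ℝ := g / hPar g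

section

variable {n : ℕ} (r : Matrix (Fin n) (Fin n) ℝ) (g : ℝ)

/-- The axial coordinate `Z = R^N`. -/
def axial (R : Fin (n + 1) → ℝ) : ℝ := R (Fin.last n)

/-- `q = √(r_{ab} R^a R^b)`. -/
def q (R : Fin (n + 1) → ℝ) : ℝ :=
  Real.sqrt (∑ a : Fin n, ∑ b : Fin n, r a b * R a.castSucc * R b.castSucc)

/-- The characteristic quadratic form `B = Z² + g q Z + q²`. -/
def B (R : Fin (n + 1) → ℝ) : ℝ :=
  axial R ^ 2 + g * q r R * axial R + q r R ^ 2

/-- `A = Z + g q / 2`. -/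
def A (R : Fin (n + 1) → ℝ) : ℝ := axial R + (1 / 2) * g * q r R

open Classical in
/-- `Φ = arctan (A / (h q))`, continued to the axis `q = 0` by `π/2` on its positive half and
by `-π/2` on its negative half. -/
def Phi (R : Fin (n + 1) → ℝ) : ℝ :=
  if q r R = 0 then (if 0 ≤ axial R then Real.pi / 2 else -(Real.pi / 2))
  else Real.arctan (A r g R / (hPar g * q r R))

/-- `J = exp (G Φ / 2)`. -/
def J (R : Fin (n + 1) → ℝ) : ℝ := Real.exp ((1 / 2) * GPar g * Phi r g R)

/-- The Finsleroid metric function `K = √B · J`. -/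
def K (R : Fin (n + 1) → ℝ) : ℝ := Real.sqrt (B r g R) * J r g R

/-- The set where `K` is smooth: the vectors off the `Z`-axis and, in the Euclidean case `g = 0`,
all nonzero vectors. -/
def regularSet : Set (Fin (n + 1) → ℝ) :=
  {R | q r R ≠ 0 ∨ (g = 0 ∧ R ≠ 0)}

/-! ### Finsler tensors -/

/-- The covector `R_p = (1/2) ∂K²/∂R^p`. -/
def lower (p : Fin (n + 1)) (R : Fin (n + 1) → ℝ) : ℝ :=
  (1 / 2) * pd p (fun X => K r g X ^ 2) R

/-- The Finsler metric tensor `g_{pq} = (1/2) ∂²K²/∂R^p∂R^q = ∂R_p/∂R^q`. -/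
def metric (R : Fin (n + 1) → ℝ) : Matrix (Fin (n + 1)) (Fin (n + 1)) ℝ :=
  Matrix.of fun s t => pd t (lower r g s) R

/-- The angular metric tensor `h_{pq} = g_{pq} - R_p R_q / K²`. -/
def angular (s t : Fin (n + 1)) (R : Fin (n + 1) → ℝ) : ℝ :=
  metric r g R s t - lower r g s R * lower r g t R / K r g R ^ 2

/-- The Cartan tensor `C_{pqr} = (1/2) ∂g_{pq}/∂R^r`. -/
def cartan (s t v : Fin (n + 1)) (R : Fin (n + 1) → ℝ) : ℝ :=
  (1 / 2) * pd v (fun X => metric r g X s t) R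

/-- The Cartan tensor with raised middle index, `C_p{}^t{}_s = g^{tu} C_{pus}`. -/
def cartanUp (s t v : Fin (n + 1)) (R : Fin (n + 1) → ℝ) : ℝ :=
  ∑ w, (metric r g R)⁻¹ t w * cartan r g s w v R

/-- The curvature tensor
`S_{abcd} = C_{tbc} C_a{}^t{}_d - C_{tbd} C_a{}^t{}_c`. -/
def curvatureS (a b c d : Fin (n + 1)) (R : Fin (n + 1) → ℝ) : ℝ :=
  ∑ t, (cartan r g t b c R * cartanUp r g a t d R - cartan r g t b d R * cartanUp r g a t c R)

/-! ### The indicatrix and its Riemannian geometry -/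

/-- The Finsleroid indicatrix `{R : K(R) = 1}`. -/
def indicatrix : Set (Fin (n + 1) → ℝ) := {R | K r g R = 1}

/-- The metric which the Finsler metric tensor induces through a parametrization `φ`:
`γ_{ij}(u) = g_{pq}(φ(u)) ∂_i φ^p ∂_j φ^q`. -/
def inducedMetric (φ : (Fin n → ℝ) → (Fin (n + 1) → ℝ)) (u : Fin n → ℝ) :
    Matrix (Fin n) (Fin n) ℝ :=
  Matrix.of fun i j => ∑ s, ∑ t,
    metric r g (φ u) s t * pd i (fun v => φ v s) u * pd j (fun v => φ v t) u

/-- `φ` is, on the open set `U`, a smooth immersion into the part of the indicatrix on which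
`K` is smooth. -/
structure IsParametrization (φ : (Fin n → ℝ) → (Fin (n + 1) → ℝ)) (U : Set (Fin n → ℝ)) :
    Prop where
  isOpen : IsOpen U
  smooth : ContDiffOn ℝ ∞ φ U
  mem_indicatrix : ∀ u ∈ U, φ u ∈ indicatrix r g
  mem_regular : ∀ u ∈ U, φ u ∈ regularSet r g
  immersion : ∀ u ∈ U, Function.Injective (fderiv ℝ φ u)

/-- A chart `e` of the whole indicatrix (it may contain points of the axis) together with a smooth
Riemannian metric `γ` on its coordinate domain which, at all points where `K` is smooth, is the
metric induced by the Finsler metric tensor. -/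
structure IsMetricChart (e : OpenPartialHomeomorph (indicatrix r g) (Fin n → ℝ))
    (γ : (Fin n → ℝ) → Matrix (Fin n) (Fin n) ℝ) : Prop where
  smooth : ∀ i j, ContDiffOn ℝ ∞ (fun u => γ u i j) e.target
  posDef : ∀ u ∈ e.target, (γ u).PosDef
  parametrization : IsParametrization r g (fun u => (e.symm u : Fin (n + 1) → ℝ))
    {u ∈ e.target | (e.symm u : Fin (n + 1) → ℝ) ∈ regularSet r g}
  induced : ∀ u ∈ e.target, (e.symm u : Fin (n + 1) → ℝ) ∈ regularSet r g →
    γ u = inducedMetric r g (fun u => (e.symm u : Fin (n + 1) → ℝ)) u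

end

end

end Finsleroid

/-!
The map `σ : R ↦ J (h R^a, A)`, read in coordinates that are orthonormal for `r ⊕ 1`, explains the
theorem. Since `B = A² + h² q²`, it carries `K` to the Euclidean norm and the indicatrix to the
unit sphere, `Φ` being the latitude. On vectors tangent to the level sets of `K` the Finsler metric
tensor is `h⁻²` times the pullback of the Euclidean metric
(`IsFrame.inner_fderiv_sphereMap_of_tangent`), so the indicatrix is locally isometric to a Euclidean
sphere of radius `1/h`.

The curvature of a sphere is obtained in coordinates, for an arbitrary immersion `X` with
`κ ‖X‖² = 1` in codimension one. The second derivatives of `X` are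
`∂_j ∂_l X = Γ^s_{lj} ∂_s X - κ γ_{lj} X` (`IsSpherical.tangent_tangent`); one more
differentiation, the symmetry of third derivatives and the inner product with `∂_i X` give
`R_{ijkl} = κ (γ_{ik} γ_{jl} - γ_{il} γ_{jk})` (`IsSpherical.hasConstantCurvatureOn`).

The inverse of `σ` on the unit sphere is `sphereInv`. It is continuous everywhere because `Φ`
becomes the arcsine of the last coordinate, and smooth away from the poles. Stereographic
projection of the sphere, composed with `σ`, therefore gives charts of the whole indicatrix in which
the metric of the sphere is smooth across the axis (`IsFrame.exists_isMetricChart`).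

For the tensors themselves put `v_p = r_{pb} R^b`, `w = v + (Z + g q) dZ` and `τ = q dZ - Z dq`.
Then `R_p = J² w_p` and `∂_p J² = J² g τ_p / B`, whence
`g_{pq} = J² (r_{pq} - v_p v_q / q² + (τ_p τ_q + w_p w_q) / B)` (`IsSpatialFrame.metric_eq`).
With `c = g τ / (2 B)` the Cartan tensor is
`h_{pq} c_r + h_{pr} c_q + h_{qr} c_p - (J² / B) τ_p τ_q c_r` (`IsSpatialFrame.cartan_eq`), where
`J² / B` is the reciprocal of `|τ|²`. For a Cartan tensor of this form the curvature tensor `S` is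
`-|c|² (h_{pr} h_{qs} - h_{ps} h_{qr})` (`sum_cartan_mul_cartanUp`), and `|c|² = g² / (4 K²)`.
Points of the axis are regular for `g = 0` only, and then `K²` is a quadratic form.
-/

namespace Finsleroid

noncomputable section

open scoped RealInnerProductSpace

/-! ### Immersions into a sphere -/

section Sphere

variable {m : ℕ} {E : Type*} [NormedAddCommGroup E] [InnerProductSpace ℝ E]

theorem fderiv_fderiv_apply_comm {V F : Type*} [NormedAddCommGroup V] [NormedSpace ℝ V]
    [NormedAddCommGroup F] [NormedSpace ℝ F] {f : V → F} {x : V} (hf : ContDiffAt ℝ 2 f x)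
    (a b : V) :
    fderiv ℝ (fun y => fderiv ℝ f y a) x b = fderiv ℝ (fun y => fderiv ℝ f y b) x a := by
  have hd : DifferentiableAt ℝ (fderiv ℝ f) x :=
    (hf.fderiv_right (m := 1) (by norm_num)).differentiableAt (by norm_num)
  have hs := hf.isSymmSndFDerivAt (by simp)
  rw [fderiv_clm_apply hd (differentiableAt_const _),
    fderiv_clm_apply hd (differentiableAt_const _)]
  simpa using hs b a

/-- The `i`-th coordinate vector field `∂_i X` of a parametrization `X`. -/
def tangent (X : (Fin m → ℝ) → E) (i : Fin m) (u : Fin m → ℝ) : E :=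
  fderiv ℝ X u (Pi.single i 1)

/-- The metric `⟪∂_i X, ∂_j X⟫` induced by the inner product of `E` through `X`. -/
def firstForm (X : (Fin m → ℝ) → E) (u : Fin m → ℝ) : Matrix (Fin m) (Fin m) ℝ :=
  Matrix.of fun i j => ⟪tangent X i u, tangent X j u⟫

/-- `X` is, on the open set `U`, a smooth immersion into the sphere `κ ‖x‖² = 1`. -/
structure IsSpherical (X : (Fin m → ℝ) → E) (κ : ℝ) (U : Set (Fin m → ℝ)) : Prop where
  isOpen : IsOpen U
  smooth : ContDiffOn ℝ ∞ X U
  mem_sphere : ∀ u ∈ U, κ * ⟪X u, X u⟫ = 1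
  immersion : ∀ u ∈ U, Function.Injective (fderiv ℝ X u)

theorem contDiffOn_tangent {X : (Fin m → ℝ) → E} {U : Set (Fin m → ℝ)} (hU : IsOpen U)
    (hX : ContDiffOn ℝ ∞ X U) (i : Fin m) : ContDiffOn ℝ ∞ (tangent X i) U :=
  (hX.fderiv_of_isOpen hU (m := ∞) (by simp)).clm_apply contDiffOn_const

theorem contDiffOn_firstForm {X : (Fin m → ℝ) → E} {U : Set (Fin m → ℝ)} (hU : IsOpen U)
    (hX : ContDiffOn ℝ ∞ X U) (i j : Fin m) : ContDiffOn ℝ ∞ (fun u => firstForm X u i j) U :=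
  (contDiffOn_tangent hU hX i).inner ℝ (contDiffOn_tangent hU hX j)

theorem contDiffOn_det {V : Type*} [NormedAddCommGroup V] [NormedSpace ℝ V] {ι : Type*}
    [Fintype ι] [DecidableEq ι] {M : V → Matrix ι ι ℝ} {U : Set V}
    (hM : ∀ i j, ContDiffOn ℝ ∞ (fun u => M u i j) U) :
    ContDiffOn ℝ ∞ (fun u => (M u).det) U := by
  simp only [Matrix.det_apply']
  exact ContDiffOn.sum fun σ _ => contDiffOn_const.mul (contDiffOn_prod fun i _ => hM _ _)

theorem contDiffOn_inv_apply {V : Type*} [NormedAddCommGroup V] [NormedSpace ℝ V] {ι : Type*}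
    [Fintype ι] [DecidableEq ι] {M : V → Matrix ι ι ℝ} {U : Set V}
    (hM : ∀ i j, ContDiffOn ℝ ∞ (fun u => M u i j) U) (hdet : ∀ u ∈ U, (M u).det ≠ 0)
    (i j : ι) : ContDiffOn ℝ ∞ (fun u => (M u)⁻¹ i j) U := by
  simp only [Matrix.inv_def, Ring.inverse_eq_inv', Matrix.smul_apply, smul_eq_mul,
    Matrix.adjugate_apply]
  refine ((contDiffOn_det hM).inv hdet).mul (contDiffOn_det fun a b => ?_)
  by_cases h : a = j
  · subst h
    simpa using contDiffOn_const
  · simpa [Matrix.updateRow_ne h] using hM a b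

theorem sum_smul_tangent (X : (Fin m → ℝ) → E) (u a : Fin m → ℝ) :
    ∑ i, a i • tangent X i u = fderiv ℝ X u a := by
  conv_rhs => rw [pi_eq_sum_univ' a]
  simp only [tangent, map_sum, map_smul]

theorem posDef_firstForm {X : (Fin m → ℝ) → E} {u : Fin m → ℝ}
    (h : Function.Injective (fderiv ℝ X u)) : (firstForm X u).PosDef := by
  have hquad : ∀ a : Fin m → ℝ,
      a ⬝ᵥ (firstForm X u).mulVec a = ⟪fderiv ℝ X u a, fderiv ℝ X u a⟫ := by
    intro a
    rw [← sum_smul_tangent]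
    simp only [dotProduct, Matrix.mulVec, firstForm, Matrix.of_apply, sum_inner, inner_sum,
      real_inner_smul_left, real_inner_smul_right, Finset.mul_sum]
    refine Finset.sum_congr rfl fun i _ => Finset.sum_congr rfl fun j _ => ?_
    rw [real_inner_comm]
    ring
  refine Matrix.PosDef.of_dotProduct_mulVec_pos ?_ fun a ha => ?_
  · ext i j
    simp [firstForm, real_inner_comm]
  · simp only [star_trivial]
    rw [hquad]
    exact real_inner_self_pos.2 fun h0 => ha (h (by simpa using h0))

theorem HasConstantCurvatureOn.congr {γ δ : (Fin m → ℝ) → Matrix (Fin m) (Fin m) ℝ} {κ : ℝ}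
    {U : Set (Fin m → ℝ)} (hδ : HasConstantCurvatureOn δ κ U) (hU : IsOpen U)
    (h : ∀ u ∈ U, γ u = δ u) : HasConstantCurvatureOn γ κ U := by
  have hpd : ∀ {f f' : (Fin m → ℝ) → ℝ}, (∀ u ∈ U, f u = f' u) → ∀ i, ∀ u ∈ U,
      pd i f u = pd i f' u := by
    intro f f' hf i u hu
    have : f =ᶠ[nhds u] f' := Filter.eventuallyEq_of_mem (hU.mem_nhds hu) hf
    simp [pd, this.fderiv_eq]
  have hγ : ∀ i j k, ∀ u ∈ U, pd k (fun v => γ v i j) u = pd k (fun v => δ v i j) u :=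
    fun i j k => hpd (fun u hu => by rw [h u hu]) k
  have hΓ : ∀ i j k, ∀ u ∈ U, christoffel γ i j k u = christoffel δ i j k u := by
    intro i j k u hu
    simp only [christoffel, h u hu, hγ _ _ _ u hu]
  intro u hu i j k l
  have := hδ u hu i j k l
  simp only [riemann, riemannUp, h u hu, hΓ _ _ _ u hu, hpd (hΓ _ _ _) _ u hu] at this ⊢
  exact this

namespace IsSpherical

variable {X : (Fin m → ℝ) → E} {κ : ℝ} {U : Set (Fin m → ℝ)} {u : Fin m → ℝ}

theorem differentiableAt (h : IsSpherical X κ U) (hu : u ∈ U) : DifferentiableAt ℝ X u :=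
  (h.smooth.contDiffAt (h.isOpen.mem_nhds hu)).differentiableAt (by simp)

theorem tangent_differentiableAt (h : IsSpherical X κ U) (hu : u ∈ U) (i : Fin m) :
    DifferentiableAt ℝ (tangent X i) u :=
  ((contDiffOn_tangent h.isOpen h.smooth i).contDiffAt
    (h.isOpen.mem_nhds hu)).differentiableAt (by simp)

theorem tangent_tangent_comm (h : IsSpherical X κ U) (hu : u ∈ U) (i j : Fin m) :
    tangent (tangent X i) j u = tangent (tangent X j) i u :=
  fderiv_fderiv_apply_comm ((h.smooth.contDiffAt (h.isOpen.mem_nhds hu)).of_le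
    (WithTop.coe_le_coe.2 le_top)) _ _

theorem tangent_tangent_tangent_comm (h : IsSpherical X κ U) (hu : u ∈ U) (i j k : Fin m) :
    tangent (tangent (tangent X i) j) k u = tangent (tangent (tangent X i) k) j u :=
  fderiv_fderiv_apply_comm (((contDiffOn_tangent h.isOpen h.smooth i).contDiffAt
    (h.isOpen.mem_nhds hu)).of_le (WithTop.coe_le_coe.2 le_top)) _ _

theorem pd_firstForm (h : IsSpherical X κ U) (hu : u ∈ U) (i j k : Fin m) :
    pd k (fun v => firstForm X v i j) u =
      ⟪tangent X i u, tangent (tangent X j) k u⟫ + ⟪tangent (tangent X i) k u, tangent X j u⟫ :=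
  fderiv_inner_apply ℝ (h.tangent_differentiableAt hu i) (h.tangent_differentiableAt hu j) _

theorem inner_tangent (h : IsSpherical X κ U) (hu : u ∈ U) (i : Fin m) :
    ⟪X u, tangent X i u⟫ = 0 := by
  have hκ : κ ≠ 0 := fun h0 => by simpa [h0] using h.mem_sphere u hu
  have hc : (fun v => ⟪X v, X v⟫) =ᶠ[nhds u] fun _ => κ⁻¹ :=
    Filter.eventuallyEq_of_mem (h.isOpen.mem_nhds hu) fun v hv => by
      have := h.mem_sphere v hv
      field_simp
      linarith
  have := fderiv_inner_apply ℝ (h.differentiableAt hu) (h.differentiableAt hu) (Pi.single i 1)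
  rw [hc.fderiv_eq] at this
  simp only [fderiv_fun_const, Pi.zero_apply, zero_apply] at this
  have h2 := real_inner_comm (X u) (fderiv ℝ X u (Pi.single i 1))
  simp only [tangent]
  linarith

theorem inner_tangent_tangent (h : IsSpherical X κ U) (hu : u ∈ U) (i j : Fin m) :
    ⟪X u, tangent (tangent X i) j u⟫ = -firstForm X u i j := by
  have hc : (fun v => ⟪X v, tangent X i v⟫) =ᶠ[nhds u] fun _ => 0 :=
    Filter.eventuallyEq_of_mem (h.isOpen.mem_nhds hu) fun v hv => h.inner_tangent hv i
  have := fderiv_inner_apply ℝ (h.differentiableAt hu) (h.tangent_differentiableAt hu i)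
    (Pi.single j 1)
  rw [hc.fderiv_eq] at this
  simp only [fderiv_fun_const, Pi.zero_apply, zero_apply] at this
  have h2 := real_inner_comm (tangent X i u) (tangent X j u)
  simp only [firstForm, Matrix.of_apply]
  simp only [tangent] at *
  linarith

/-- The Christoffel symbols of the first kind of an induced metric are `⟪∂_l X, ∂_j ∂_k X⟫`. -/
theorem christoffel_firstForm (h : IsSpherical X κ U) (hu : u ∈ U) (i j k : Fin m) :
    christoffel (firstForm X) i j k u =
      ∑ l, (firstForm X u)⁻¹ i l * ⟪tangent X l u, tangent (tangent X k) j u⟫ := by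
  rw [christoffel, Finset.mul_sum]
  refine Finset.sum_congr rfl fun l _ => ?_
  rw [h.pd_firstForm hu, h.pd_firstForm hu, h.pd_firstForm hu, h.tangent_tangent_comm hu j k,
    h.tangent_tangent_comm hu l j, h.tangent_tangent_comm hu l k,
    real_inner_comm (tangent (tangent X k) l u) (tangent X j u)]
  ring

theorem isUnit_det (h : IsSpherical X κ U) (hu : u ∈ U) : IsUnit (firstForm X u).det :=
  (posDef_firstForm (h.immersion u hu)).det_pos.ne'.isUnit

theorem sum_firstForm_mul_christoffel (h : IsSpherical X κ U) (hu : u ∈ U) (i j k : Fin m) :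
    ∑ s, firstForm X u i s * christoffel (firstForm X) s j k u =
      ⟪tangent X i u, tangent (tangent X k) j u⟫ := by
  simp only [h.christoffel_firstForm hu]
  have := congrFun (congrArg (fun M : Matrix (Fin m) (Fin m) ℝ =>
    M.mulVec fun l => ⟪tangent X l u, tangent (tangent X k) j u⟫)
    (Matrix.mul_nonsing_inv _ (h.isUnit_det hu))) i
  simp only [← Matrix.mulVec_mulVec, Matrix.one_mulVec] at this
  simpa [Matrix.mulVec, dotProduct] using this

theorem differentiableAt_christoffel (h : IsSpherical X κ U) (hu : u ∈ U) (i j k : Fin m) :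
    DifferentiableAt ℝ (christoffel (firstForm X) i j k) u := by
  have hc : ContDiffOn ℝ ∞ (fun u => ∑ l, (firstForm X u)⁻¹ i l *
      ⟪tangent X l u, tangent (tangent X k) j u⟫) U :=
    ContDiffOn.sum fun l _ => (contDiffOn_inv_apply (contDiffOn_firstForm h.isOpen h.smooth)
      (fun u hu => (h.isUnit_det hu).ne_zero) i l).mul
      ((contDiffOn_tangent h.isOpen h.smooth l).inner ℝ
        (contDiffOn_tangent h.isOpen (contDiffOn_tangent h.isOpen h.smooth k) j))
  exact (((hc.congr fun u hu => h.christoffel_firstForm hu i j k).contDiffAt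
    (h.isOpen.mem_nhds hu)).differentiableAt (by simp))

/-- The Gauss formula of the sphere. The position vector spans the normal line, because the
codimension is one. -/
theorem tangent_tangent [FiniteDimensional ℝ E] (h : IsSpherical X κ U)
    (hE : Module.finrank ℝ E = m + 1) (hu : u ∈ U) (j l : Fin m) :
    tangent (tangent X j) l u =
      ∑ s, christoffel (firstForm X) s l j u • tangent X s u - (κ * firstForm X u l j) • X u := by
  have hX0 : X u ≠ 0 := fun h0 => by simpa [h0] using h.mem_sphere u hu
  set b : Option (Fin m) → E := fun o => o.elim (X u) fun i => tangent X i u with hb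
  have hli : LinearIndependent ℝ b := by
    rw [Fintype.linearIndependent_iff]
    intro c hc
    simp only [Fintype.sum_option, hb, Option.elim] at hc
    have h1 : c none = 0 := by
      have := congrArg (fun y => ⟪X u, y⟫) hc
      simp only [inner_add_right, inner_sum, real_inner_smul_right, h.inner_tangent hu, mul_zero,
        Finset.sum_const_zero, add_zero, inner_zero_right, mul_eq_zero] at this
      exact this.resolve_right (real_inner_self_pos.2 hX0).ne'
    rw [h1, zero_smul, zero_add, sum_smul_tangent X u (fun i => c (some i))] at hc
    have h2 := h.immersion u hu (hc.trans (map_zero _).symm)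
    rintro (_ | i)
    · exact h1
    · exact congrFun h2 i
  have hspan := hli.span_eq_top_of_card_eq_finrank' (by simp [hE])
  -- the difference of both sides is orthogonal to the basis formed by `X` and the `∂_i X`
  rw [← sub_eq_zero]
  set W := tangent (tangent X j) l u -
    (∑ s, christoffel (firstForm X) s l j u • tangent X s u - (κ * firstForm X u l j) • X u)
  have hW : ∀ y : E, ⟪y, W⟫ = 0 := by
    intro y
    have hy : y ∈ Submodule.span ℝ (Set.range b) := hspan ▸ Submodule.mem_top
    induction hy using Submodule.span_induction with
    | mem y hy =>
      obtain ⟨_ | i, rfl⟩ := hy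
      · simp only [hb, Option.elim, W, inner_sub_right, inner_sum, real_inner_smul_right,
          h.inner_tangent hu, h.inner_tangent_tangent hu, mul_zero, Finset.sum_const_zero]
        have h1 := h.mem_sphere u hu
        have h2 : firstForm X u j l = firstForm X u l j := by
          simp [firstForm, real_inner_comm]
        rw [h2]
        linear_combination firstForm X u l j * h1
      · have h3 := h.sum_firstForm_mul_christoffel hu i l j
        have h4 := real_inner_comm (X u) (tangent X i u)
        rw [h.inner_tangent hu] at h4
        simp only [hb, Option.elim, W, inner_sub_right, inner_sum, real_inner_smul_right, h4]
        rw [← h3]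
        simp [firstForm, mul_comm]
    | zero => simp
    | add x y _ _ hx hy => rw [inner_add_left, hx, hy, add_zero]
    | smul c x _ hx => rw [real_inner_smul_left, hx, mul_zero]
  exact inner_self_eq_zero.1 (hW W)

/-- Differentiating the Gauss formula once more and projecting onto `∂_i X`. -/
theorem inner_tangent_tangent_tangent [FiniteDimensional ℝ E] (h : IsSpherical X κ U)
    (hE : Module.finrank ℝ E = m + 1) (hu : u ∈ U) (i j k l : Fin m) :
    ⟪tangent X i u, tangent (tangent (tangent X j) l) k u⟫ =
      ∑ s, firstForm X u i s * (pd k (christoffel (firstForm X) s l j) u +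
        ∑ t, christoffel (firstForm X) s k t u * christoffel (firstForm X) t l j u)
      - κ * (firstForm X u i k * firstForm X u l j) := by
  have hev : tangent (tangent X j) l =ᶠ[nhds u] fun v =>
      ∑ s, christoffel (firstForm X) s l j v • tangent X s v - (κ * firstForm X v l j) • X v :=
    Filter.eventuallyEq_of_mem (h.isOpen.mem_nhds hu) fun v hv => h.tangent_tangent hE hv j l
  have hγ : DifferentiableAt ℝ (fun v => κ * firstForm X v l j) u :=
    (((contDiffOn_firstForm h.isOpen h.smooth l j).contDiffAt
      (h.isOpen.mem_nhds hu)).differentiableAt (by simp)).const_mul κ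
  have hd : HasFDerivAt (fun v => ∑ s, christoffel (firstForm X) s l j v • tangent X s v -
      (κ * firstForm X v l j) • X v) _ u := (HasFDerivAt.fun_sum (u := Finset.univ) fun s _ =>
    (h.differentiableAt_christoffel hu s l j).hasFDerivAt.smul
      (h.tangent_differentiableAt hu s).hasFDerivAt).sub
    (hγ.hasFDerivAt.smul (h.differentiableAt hu).hasFDerivAt)
  have h4 := real_inner_comm (X u) (tangent X i u)
  rw [h.inner_tangent hu] at h4
  rw [show tangent (tangent (tangent X j) l) k u =
    fderiv ℝ (tangent (tangent X j) l) u (Pi.single k 1) from rfl, hev.fderiv_eq, hd.fderiv]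
  simp only [sub_apply, sum_apply,
    add_apply, smul_apply,
    ContinuousLinearMap.smulRight_apply, inner_sub_right, inner_sum, inner_add_right,
    real_inner_smul_right, h4, mul_zero, add_zero]
  have h5 : ∀ s, ⟪tangent X i u, fderiv ℝ (tangent X s) u (Pi.single k 1)⟫ =
      ∑ t, firstForm X u i t * christoffel (firstForm X) t k s u := fun s =>
    (h.sum_firstForm_mul_christoffel hu i k s).symm
  simp only [h5, mul_add, Finset.sum_add_distrib, Finset.mul_sum]
  have h6 : ∑ s, ∑ t, firstForm X u i s *
      (christoffel (firstForm X) s k t u * christoffel (firstForm X) t l j u) =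
      ∑ s, ∑ t, christoffel (firstForm X) s l j u *
        (firstForm X u i t * christoffel (firstForm X) t k s u) := by
    rw [Finset.sum_comm]
    exact Finset.sum_congr rfl fun s _ => Finset.sum_congr rfl fun t _ => by ring
  rw [h6]
  have h7 : ∀ s, ⟪tangent X i u, tangent X s u⟫ = firstForm X u i s := fun s => rfl
  have h8 : ⟪tangent X i u, fderiv ℝ X u (Pi.single k 1)⟫ = firstForm X u i k := rfl
  simp only [h7, h8, pd]
  have h9 : ∑ s, firstForm X u i s *
      (fderiv ℝ (christoffel (firstForm X) s l j) u) (Pi.single k 1) =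
      ∑ s, (fderiv ℝ (christoffel (firstForm X) s l j) u) (Pi.single k 1) *
        firstForm X u i s := Finset.sum_congr rfl fun s _ => mul_comm _ _
  rw [h9]
  ring

theorem hasConstantCurvatureOn [FiniteDimensional ℝ E] (h : IsSpherical X κ U)
    (hE : Module.finrank ℝ E = m + 1) : HasConstantCurvatureOn (firstForm X) κ U := by
  intro u hu i j k l
  have h1 := h.inner_tangent_tangent_tangent hE hu i j k l
  have h2 := h.inner_tangent_tangent_tangent hE hu i j l k
  -- `∂_k ∂_l ∂_j X = ∂_l ∂_k ∂_j X` is the only integrability condition needed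
  rw [h.tangent_tangent_tangent_comm hu j k l, h1] at h2
  have hs : ∀ a b, firstForm X u a b = firstForm X u b a := fun a b => by
    simp [firstForm, real_inner_comm]
  rw [hs j l, hs j k]
  simp only [riemann, riemannUp, Finset.sum_sub_distrib, mul_add, mul_sub,
    Finset.sum_add_distrib] at h2 ⊢
  linarith

end IsSpherical

end Sphere

/-! ### The Finsler tensors off the axis -/

section Tensors

variable {n : ℕ} {F : Type*} [NormedAddCommGroup F] [InnerProductSpace ℝ F]
  {r : Matrix (Fin n) (Fin n) ℝ} {g : ℝ} {ρ : (Fin (n + 1) → ℝ) →L[ℝ] F} {R : Fin (n + 1) → ℝ}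

/-- The linear map `ρ` represents the quadratic form `r_{ab} R^a R^b` as a squared norm. -/
def IsSpatialFrame (r : Matrix (Fin n) (Fin n) ℝ) (ρ : (Fin (n + 1) → ℝ) →L[ℝ] F) : Prop :=
  ∀ x y, ⟪ρ x, ρ y⟫ = ∑ a : Fin n, ∑ b : Fin n, r a b * x a.castSucc * y b.castSucc

/-- The covector `v_p = r_{pb} R^b`, with vanishing axial component. -/
def spatial (ρ : (Fin (n + 1) → ℝ) →L[ℝ] F) (R : Fin (n + 1) → ℝ) :
    (Fin (n + 1) → ℝ) →L[ℝ] ℝ :=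
  (innerSL ℝ (ρ R)).comp ρ

/-- The covector `dZ`. -/
def axialL : (Fin (n + 1) → ℝ) →L[ℝ] ℝ := ContinuousLinearMap.proj (Fin.last n)

/-- The covector `w = v + (Z + g q) dZ`, which is `R_p` divided by `J²`. -/
def radialForm (r : Matrix (Fin n) (Fin n) ℝ) (g : ℝ) (ρ : (Fin (n + 1) → ℝ) →L[ℝ] F)
    (R : Fin (n + 1) → ℝ) : (Fin (n + 1) → ℝ) →L[ℝ] ℝ :=
  spatial ρ R + (axial R + g * q r R) • axialL

/-- The covector `τ = q dZ - Z dq`, which is proportional to `dΦ` and to the trace `C_p` of the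
Cartan tensor. -/
def angleForm (r : Matrix (Fin n) (Fin n) ℝ) (ρ : (Fin (n + 1) → ℝ) →L[ℝ] F)
    (R : Fin (n + 1) → ℝ) : (Fin (n + 1) → ℝ) →L[ℝ] ℝ :=
  q r R • axialL - (axial R / q r R) • spatial ρ R

theorem hPar_sq (hg₁ : -2 < g) (hg₂ : g < 2) : hPar g ^ 2 = 1 - g ^ 2 / 4 :=
  Real.sq_sqrt (by nlinarith)

theorem hPar_pos (hg₁ : -2 < g) (hg₂ : g < 2) : 0 < hPar g := Real.sqrt_pos.2 (by nlinarith)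

theorem spatial_apply (x : Fin (n + 1) → ℝ) : spatial ρ R x = ⟪ρ R, ρ x⟫ := rfl

theorem axialL_apply (x : Fin (n + 1) → ℝ) : axialL x = axial x := rfl

theorem radialForm_apply (x : Fin (n + 1) → ℝ) :
    radialForm r g ρ R x = ⟪ρ R, ρ x⟫ + (axial R + g * q r R) * axial x := rfl

theorem angleForm_apply (x : Fin (n + 1) → ℝ) :
    angleForm r ρ R x = q r R * axial x - axial R / q r R * ⟪ρ R, ρ x⟫ := rfl

theorem B_eq_sq_add_sq (hg₁ : -2 < g) (hg₂ : g < 2) :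
    B r g R = A r g R ^ 2 + (hPar g * q r R) ^ 2 := by
  rw [mul_pow, hPar_sq hg₁ hg₂, B, A]
  ring

theorem B_pos_of_q_ne_zero (hg₁ : -2 < g) (hg₂ : g < 2) (hq : q r R ≠ 0) : 0 < B r g R := by
  rw [B_eq_sq_add_sq hg₁ hg₂]
  have := hPar_pos hg₁ hg₂
  positivity

theorem J_pos : 0 < J r g R := Real.exp_pos _

theorem K_sq (hB : 0 ≤ B r g R) : K r g R ^ 2 = B r g R * J r g R ^ 2 := by
  rw [K, mul_pow, Real.sq_sqrt hB]

namespace IsSpatialFrame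

theorem q_eq_norm (hρ : IsSpatialFrame r ρ) : q r R = ‖ρ R‖ := by
  rw [q, ← hρ, real_inner_self_eq_norm_sq, Real.sqrt_sq (norm_nonneg _)]

theorem inner_self (hρ : IsSpatialFrame r ρ) : ⟪ρ R, ρ R⟫ = q r R ^ 2 := by
  rw [hρ.q_eq_norm, real_inner_self_eq_norm_sq]

theorem continuous_q (hρ : IsSpatialFrame r ρ) : Continuous (q r) := by
  rw [show q r = fun R => ‖ρ R‖ from funext fun R => hρ.q_eq_norm]
  fun_prop

theorem eventually_q_ne_zero (hρ : IsSpatialFrame r ρ) (hq : q r R ≠ 0) :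
    ∀ᶠ X in nhds R, q r X ≠ 0 :=
  hρ.continuous_q.continuousAt.eventually_ne hq

/-! ### First derivatives -/

theorem hasFDerivAt_q (hρ : IsSpatialFrame r ρ) (hq : q r R ≠ 0) :
    HasFDerivAt (q r) ((1 / q r R) • spatial ρ R) R := by
  have h0 : ‖ρ R‖ ≠ 0 := by rwa [← hρ.q_eq_norm]
  have h1 := (ρ.hasFDerivAt (x := R)).norm_sq.sqrt (by positivity)
  have h2 : (fun X => √(‖ρ X‖ ^ 2)) = q r := funext fun X => by
    rw [hρ.q_eq_norm, Real.sqrt_sq (norm_nonneg _)]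
  rw [h2] at h1
  refine h1.congr_fderiv ?_
  ext x
  simp only [smul_apply, spatial_apply, Real.sqrt_sq (norm_nonneg _), hρ.q_eq_norm,
    ContinuousLinearMap.comp_apply, innerSL_apply_apply, smul_eq_mul, nsmul_eq_mul]
  push_cast
  field_simp

theorem hasFDerivAt_axial : HasFDerivAt (axial (n := n)) axialL R :=
  (axialL (n := n)).hasFDerivAt

theorem hasFDerivAt_A (hρ : IsSpatialFrame r ρ) (hq : q r R ≠ 0) :
    HasFDerivAt (A r g) (axialL + (g / (2 * q r R)) • spatial ρ R) R := by
  refine (hasFDerivAt_axial.add ((hρ.hasFDerivAt_q hq).const_mul (1 / 2 * g))).congr_fderiv ?_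
  ext x
  simp only [smul_apply, add_apply, smul_eq_mul]
  field_simp

theorem hasFDerivAt_B (hρ : IsSpatialFrame r ρ) (hq : q r R ≠ 0) :
    HasFDerivAt (B r g) ((2 * axial R + g * q r R) • axialL +
      (g * axial R / q r R + 2) • spatial ρ R) R := by
  have h := hρ.hasFDerivAt_q hq
  refine (((hasFDerivAt_axial.pow 2).add ((h.const_mul g).mul hasFDerivAt_axial)).add
    (h.pow 2)).congr_fderiv ?_
  ext x
  simp only [smul_apply, add_apply, smul_eq_mul, nsmul_eq_mul]
  field_simp
  ring

theorem Phi_eventuallyEq (hρ : IsSpatialFrame r ρ) (hq : q r R ≠ 0) :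
    Phi r g =ᶠ[nhds R] fun X => Real.arctan (A r g X / (hPar g * q r X)) := by
  filter_upwards [hρ.eventually_q_ne_zero hq] with X hX
  rw [Phi, if_neg hX]

theorem hasFDerivAt_Phi (hg₁ : -2 < g) (hg₂ : g < 2) (hρ : IsSpatialFrame r ρ)
    (hq : q r R ≠ 0) :
    HasFDerivAt (Phi r g) ((hPar g / B r g R) • angleForm r ρ R) R := by
  have hh := (hPar_pos hg₁ hg₂).ne'
  have hB := (B_pos_of_q_ne_zero hg₁ hg₂ hq).ne'
  have h := ((hρ.hasFDerivAt_A (g := g) hq).mul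
    ((hasDerivAt_inv (mul_ne_zero hh hq)).comp_hasFDerivAt R
      ((hρ.hasFDerivAt_q hq).const_mul (hPar g)))).arctan
  refine (h.congr_fderiv ?_).congr_of_eventuallyEq ?_
  · ext x
    simp only [smul_apply, add_apply, smul_eq_mul, angleForm_apply, spatial_apply, axialL_apply,
      Function.comp_apply, Pi.mul_apply]
    have hden : 1 + (A r g R * (hPar g * q r R)⁻¹) ^ 2 = B r g R / (hPar g * q r R) ^ 2 := by
      rw [B_eq_sq_add_sq hg₁ hg₂]
      field_simp
      ring
    rw [hden, A]
    field_simp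
    ring
  · exact (hρ.Phi_eventuallyEq hq).trans (Filter.Eventually.of_forall fun X => by
      simp [div_eq_mul_inv])

theorem hasFDerivAt_J (hg₁ : -2 < g) (hg₂ : g < 2) (hρ : IsSpatialFrame r ρ) (hq : q r R ≠ 0) :
    HasFDerivAt (J r g) ((J r g R * (g / (2 * B r g R))) • angleForm r ρ R) R := by
  have hh := (hPar_pos hg₁ hg₂).ne'
  refine ((hρ.hasFDerivAt_Phi hg₁ hg₂ hq).const_mul (1 / 2 * GPar g)).exp.congr_fderiv ?_
  rw [smul_smul, smul_smul]
  congr 1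
  rw [J, GPar]
  field_simp

theorem hasFDerivAt_J_sq (hg₁ : -2 < g) (hg₂ : g < 2) (hρ : IsSpatialFrame r ρ)
    (hq : q r R ≠ 0) :
    HasFDerivAt (fun X => J r g X ^ 2) ((J r g R ^ 2 * (g / B r g R)) • angleForm r ρ R) R := by
  have hB := (B_pos_of_q_ne_zero hg₁ hg₂ hq).ne'
  refine ((hρ.hasFDerivAt_J hg₁ hg₂ hq).pow 2).congr_fderiv ?_
  rw [smul_smul]
  congr 1
  simp only [nsmul_eq_mul]
  push_cast
  field_simp

theorem K_sq_eventuallyEq (hg₁ : -2 < g) (hg₂ : g < 2) (hρ : IsSpatialFrame r ρ)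
    (hq : q r R ≠ 0) :
    (fun X => K r g X ^ 2) =ᶠ[nhds R] fun X => B r g X * J r g X ^ 2 := by
  filter_upwards [hρ.eventually_q_ne_zero hq] with X hX
  exact K_sq (B_pos_of_q_ne_zero hg₁ hg₂ hX).le

theorem hasFDerivAt_K_sq (hg₁ : -2 < g) (hg₂ : g < 2) (hρ : IsSpatialFrame r ρ)
    (hq : q r R ≠ 0) :
    HasFDerivAt (fun X => K r g X ^ 2) ((2 * J r g R ^ 2) • radialForm r g ρ R) R := by
  have hB := (B_pos_of_q_ne_zero hg₁ hg₂ hq).ne'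
  refine (((hρ.hasFDerivAt_B hq).mul (hρ.hasFDerivAt_J_sq hg₁ hg₂ hq)).congr_fderiv
    ?_).congr_of_eventuallyEq (hρ.K_sq_eventuallyEq hg₁ hg₂ hq)
  ext x
  simp only [smul_apply, add_apply, smul_eq_mul, angleForm_apply, spatial_apply, axialL_apply,
    radialForm_apply]
  field_simp
  ring

/-! ### The metric tensor and the Cartan tensor -/

theorem lower_eq (hg₁ : -2 < g) (hg₂ : g < 2) (hρ : IsSpatialFrame r ρ) (hq : q r R ≠ 0)
    (s : Fin (n + 1)) : lower r g s R = J r g R ^ 2 * radialForm r g ρ R (Pi.single s 1) := by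
  rw [lower, pd, (hρ.hasFDerivAt_K_sq hg₁ hg₂ hq).fderiv, smul_apply, smul_eq_mul]
  ring

theorem hasFDerivAt_spatial (x : Fin (n + 1) → ℝ) :
    HasFDerivAt (fun X => ⟪ρ X, ρ x⟫) ((innerSL ℝ (ρ x)).comp ρ) R := by
  have h := ((innerSL ℝ (ρ x)).comp ρ).hasFDerivAt (x := R)
  refine h.congr_of_eventuallyEq (Filter.Eventually.of_forall fun X => ?_)
  exact real_inner_comm _ _

theorem hasFDerivAt_radialForm (hρ : IsSpatialFrame r ρ) (hq : q r R ≠ 0)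
    (x : Fin (n + 1) → ℝ) :
    HasFDerivAt (fun X => radialForm r g ρ X x) ((innerSL ℝ (ρ x)).comp ρ +
      axial x • (axialL + (g / q r R) • spatial ρ R)) R := by
  refine ((hasFDerivAt_spatial x).add ((hasFDerivAt_axial.add
    ((hρ.hasFDerivAt_q hq).const_mul g)).mul_const (axial x))).congr_fderiv ?_
  ext y
  simp only [smul_apply, add_apply, smul_eq_mul]
  ring

theorem hasFDerivAt_angleForm (hρ : IsSpatialFrame r ρ) (hq : q r R ≠ 0)
    (x : Fin (n + 1) → ℝ) :
    HasFDerivAt (fun X => angleForm r ρ X x) ((axial x / q r R) • spatial ρ R -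
      (⟪ρ R, ρ x⟫ / q r R) • axialL + (⟪ρ R, ρ x⟫ * axial R / q r R ^ 3) • spatial ρ R
      - (axial R / q r R) • (innerSL ℝ (ρ x)).comp ρ) R := by
  refine (((hρ.hasFDerivAt_q hq).mul_const (axial x)).sub
    ((hasFDerivAt_axial.mul ((hasDerivAt_inv hq).comp_hasFDerivAt R
      (hρ.hasFDerivAt_q hq))).mul (hasFDerivAt_spatial x))).congr_fderiv ?_
  ext y
  simp only [smul_apply, add_apply, sub_apply, smul_eq_mul, Function.comp_apply, Pi.mul_apply]
  field_simp
  ring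

/-- The metric tensor is `J² (E + (τ ⊗ τ + w ⊗ w) / B)`, where `E` is the part of `r` that is
orthogonal to `v`. -/
theorem metric_eq (hg₁ : -2 < g) (hg₂ : g < 2) (hρ : IsSpatialFrame r ρ) (hq : q r R ≠ 0)
    (s t : Fin (n + 1)) : metric r g R s t = J r g R ^ 2 *
      (⟪ρ (Pi.single s 1), ρ (Pi.single t 1)⟫
        - spatial ρ R (Pi.single s 1) * spatial ρ R (Pi.single t 1) / q r R ^ 2
        + (angleForm r ρ R (Pi.single s 1) * angleForm r ρ R (Pi.single t 1)
          + radialForm r g ρ R (Pi.single s 1) * radialForm r g ρ R (Pi.single t 1))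
            / B r g R) := by
  have hB := (B_pos_of_q_ne_zero hg₁ hg₂ hq).ne'
  have hev : lower r g s =ᶠ[nhds R] fun X => J r g X ^ 2 * radialForm r g ρ X (Pi.single s 1) := by
    filter_upwards [hρ.eventually_q_ne_zero hq] with X hX
    exact hρ.lower_eq hg₁ hg₂ hX s
  have hd := ((hρ.hasFDerivAt_J_sq hg₁ hg₂ hq).mul
    (hρ.hasFDerivAt_radialForm (g := g) hq (Pi.single s 1))).fderiv
  rw [metric, Matrix.of_apply, pd, hev.fderiv_eq]
  refine (congrArg (fun L : (Fin (n + 1) → ℝ) →L[ℝ] ℝ => L (Pi.single t 1)) hd).trans ?_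
  simp only [smul_apply, add_apply, smul_eq_mul, angleForm_apply, spatial_apply, axialL_apply,
    radialForm_apply, ContinuousLinearMap.comp_apply, innerSL_apply_apply]
  generalize ⟪ρ R, ρ (Pi.single s 1)⟫ = vs
  generalize ⟪ρ R, ρ (Pi.single t 1)⟫ = vt
  generalize axial (n := n) (Pi.single s 1) = zs
  generalize axial (n := n) (Pi.single t 1) = zt
  field_simp
  rw [B]
  ring

/-- The Cartan tensor off the axis. Besides the angular metric it involves the covector `τ` only. -/
theorem cartan_eq (hg₁ : -2 < g) (hg₂ : g < 2) (hρ : IsSpatialFrame r ρ) (hq : q r R ≠ 0)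
    (s t u : Fin (n + 1)) : cartan r g s t u R = J r g R ^ 2 * (g / (2 * B r g R)) *
      ((⟪ρ (Pi.single s 1), ρ (Pi.single t 1)⟫
          - spatial ρ R (Pi.single s 1) * spatial ρ R (Pi.single t 1) / q r R ^ 2)
          * angleForm r ρ R (Pi.single u 1)
        + (⟪ρ (Pi.single s 1), ρ (Pi.single u 1)⟫
          - spatial ρ R (Pi.single s 1) * spatial ρ R (Pi.single u 1) / q r R ^ 2)
          * angleForm r ρ R (Pi.single t 1)
        + (⟪ρ (Pi.single t 1), ρ (Pi.single u 1)⟫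
          - spatial ρ R (Pi.single t 1) * spatial ρ R (Pi.single u 1) / q r R ^ 2)
          * angleForm r ρ R (Pi.single s 1)
        + 2 * angleForm r ρ R (Pi.single s 1) * angleForm r ρ R (Pi.single t 1)
          * angleForm r ρ R (Pi.single u 1) / B r g R) := by
  have hB := (B_pos_of_q_ne_zero hg₁ hg₂ hq).ne'
  have hev : (fun X => metric r g X s t) =ᶠ[nhds R] fun X => J r g X ^ 2 *
      (⟪ρ (Pi.single s 1), ρ (Pi.single t 1)⟫
        - ⟪ρ X, ρ (Pi.single s 1)⟫ * ⟪ρ X, ρ (Pi.single t 1)⟫ * (q r X ^ 2)⁻¹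
        + (angleForm r ρ X (Pi.single s 1) * angleForm r ρ X (Pi.single t 1)
          + radialForm r g ρ X (Pi.single s 1) * radialForm r g ρ X (Pi.single t 1))
            * (B r g X)⁻¹) := by
    filter_upwards [hρ.eventually_q_ne_zero hq] with X hX
    exact hρ.metric_eq hg₁ hg₂ hX s t
  have hv := fun x => hasFDerivAt_spatial (ρ := ρ) (R := R) x
  have hτ := fun x => hρ.hasFDerivAt_angleForm hq x
  have hw := fun x => hρ.hasFDerivAt_radialForm (g := g) hq x
  have hd := (hρ.hasFDerivAt_J_sq hg₁ hg₂ hq).mul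
    ((((hasFDerivAt_const ⟪ρ (Pi.single s 1), ρ (Pi.single t 1)⟫ R).sub
      (((hv (Pi.single s 1)).mul (hv (Pi.single t 1))).mul
        ((hasDerivAt_inv (pow_ne_zero 2 hq)).comp_hasFDerivAt R
          ((hρ.hasFDerivAt_q hq).pow 2)))).add
      ((((hτ (Pi.single s 1)).mul (hτ (Pi.single t 1))).add
        ((hw (Pi.single s 1)).mul (hw (Pi.single t 1)))).mul
          ((hasDerivAt_inv hB).comp_hasFDerivAt R (hρ.hasFDerivAt_B (g := g) hq)))))
  have hd' := hd.fderiv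
  rw [cartan, pd, hev.fderiv_eq]
  refine (congrArg (fun L : (Fin (n + 1) → ℝ) →L[ℝ] ℝ => 1 / 2 * L (Pi.single u 1)) hd').trans ?_
  simp only [smul_apply, add_apply, sub_apply, smul_eq_mul, nsmul_eq_mul, zero_apply,
    angleForm_apply, spatial_apply, axialL_apply, radialForm_apply,
    ContinuousLinearMap.comp_apply, innerSL_apply_apply, Function.comp_apply, Pi.mul_apply,
    Pi.add_apply, Pi.sub_apply]
  generalize ⟪ρ R, ρ (Pi.single s 1)⟫ = vs
  generalize ⟪ρ R, ρ (Pi.single t 1)⟫ = vt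
  generalize ⟪ρ R, ρ (Pi.single u 1)⟫ = vu
  generalize axial (n := n) (Pi.single s 1) = zs
  generalize axial (n := n) (Pi.single t 1) = zt
  generalize axial (n := n) (Pi.single u 1) = zu
  generalize ⟪ρ (Pi.single s 1), ρ (Pi.single t 1)⟫ = rst
  generalize ⟪ρ (Pi.single s 1), ρ (Pi.single u 1)⟫ = rsu
  generalize ⟪ρ (Pi.single t 1), ρ (Pi.single u 1)⟫ = rtu
  push_cast
  field_simp
  rw [B]
  ring

end IsSpatialFrame

end Tensors

/-! ### Positivity and the curvature tensor -/

section Curvature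

/-- The algebra behind the curvature tensor `S`, with `α` for `J²`, `β` for `B` and `κ` for `K²`.
If `τ` annihilates the radial direction `X`, then after expansion the only part of
`C_{tbc} C_a{}^t{}_d` that is not symmetric in `c` and `d` is `k² (β / α) h_{ad} h_{bc}`. The
indices of `y` and `τ` are raised by exhibiting vectors `X` and `T`, so the inverse matrix never has
to be computed. -/
theorem sum_cartan_mul_cartanUp {ι : Type*} [Fintype ι] [DecidableEq ι] {M : Matrix ι ι ℝ}
    (hM : IsUnit M.det) {h : ι → ι → ℝ} {C : ι → ι → ι → ℝ} {y τ X T : ι → ℝ} {k α β κ : ℝ}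
    (hα : α ≠ 0) (hβ : β ≠ 0)
    (hh : ∀ s t, h s t = M s t - y s * y t / κ) (hsymm : ∀ s t, h s t = h t s)
    (hX : M.mulVec X = y) (hhX : ∀ s, ∑ t, h s t * X t = 0)
    (hT : M.mulVec T = fun s => α * τ s) (hyT : ∑ t, y t * T t = 0)
    (hτX : ∑ t, τ t * X t = 0) (hτT : ∑ t, τ t * T t = β)
    (hC : ∀ s t u, C s t u =
      k * (h s t * τ u + h s u * τ t + h t u * τ s - α / β * (τ s * τ t * τ u)))
    (a b c d : ι) :
    ∑ t, (C t b c * ∑ w, M⁻¹ t w * C a w d - C t b d * ∑ w, M⁻¹ t w * C a w c) =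
      -(k ^ 2 * (β / α)) * (h a c * h b d - h a d * h b c) := by
  have hMT : ∀ w, ∑ t, M w t * T t = α * τ w := fun w => congrFun hT w
  have hMX : ∀ w, ∑ t, M w t * X t = y w := fun w => congrFun hX w
  have hup : ∀ a d t, ∑ w, M⁻¹ t w * C a w d =
      k * (((1 : Matrix ι ι ℝ) t a - X t * y a / κ) * τ d
        + ((1 : Matrix ι ι ℝ) t d - X t * y d / κ) * τ a
        + (h a d / α - τ a * τ d / β) * T t) := by
    intro a d t
    -- lowering the index of the claimed value gives back `C`
    set f : ι → ℝ := fun t => k * (((1 : Matrix ι ι ℝ) t a - X t * y a / κ) * τ d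
        + ((1 : Matrix ι ι ℝ) t d - X t * y d / κ) * τ a
        + (h a d / α - τ a * τ d / β) * T t) with hf
    have hMf : M.mulVec f = fun w => C a w d := by
      funext w
      have h1 : ∀ e, ∑ t, M w t * (1 : Matrix ι ι ℝ) t e = M w e := fun e => by
        simp [Matrix.one_apply]
      have h2 : M.mulVec f w = k * ((∑ t, M w t * (1 : Matrix ι ι ℝ) t a
          - (∑ t, M w t * X t) * y a / κ) * τ d
          + (∑ t, M w t * (1 : Matrix ι ι ℝ) t d - (∑ t, M w t * X t) * y d / κ) * τ a
          + (h a d / α - τ a * τ d / β) * ∑ t, M w t * T t) := by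
        simp only [Matrix.mulVec, dotProduct, hf, Finset.mul_sum, Finset.sum_mul, Finset.sum_div,
          ← Finset.sum_add_distrib, ← Finset.sum_sub_distrib]
        exact Finset.sum_congr rfl fun t _ => by ring
      rw [h2, h1, h1, hMX, hMT, ← hh, ← hh, hC, hsymm w a]
      field_simp
      ring
    have h3 : M⁻¹.mulVec (M.mulVec f) = f := by
      rw [Matrix.mulVec_mulVec, Matrix.nonsing_inv_mul _ hM, Matrix.one_mulVec]
    rw [hMf] at h3
    exact congrFun h3 t
  have hhT : ∀ s, ∑ t, h t s * T t = α * τ s := by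
    intro s
    have h1 : ∑ t, h t s * T t = ∑ t, M s t * T t - y s / κ * ∑ t, y t * T t := by
      rw [Finset.mul_sum, ← Finset.sum_sub_distrib]
      exact Finset.sum_congr rfl fun t _ => by rw [hsymm t s, hh]; ring
    rw [h1, hMT, hyT, mul_zero, sub_zero]
  have hCX : ∀ b c, ∑ t, C t b c * X t = 0 := by
    intro b c
    have h1 : ∑ t, C t b c * X t = k * ((∑ t, h b t * X t) * τ c + (∑ t, h c t * X t) * τ b
        + h b c * ∑ t, τ t * X t - α / β * (τ b * τ c) * ∑ t, τ t * X t) := by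
      simp only [Finset.mul_sum, Finset.sum_mul, ← Finset.sum_add_distrib,
        ← Finset.sum_sub_distrib]
      exact Finset.sum_congr rfl fun t _ => by rw [hC, hsymm t b, hsymm t c]; ring
    rw [h1, hhX, hhX, hτX]
    ring
  have hCT : ∀ b c, ∑ t, C t b c * T t = k * (α * τ b * τ c + h b c * β) := by
    intro b c
    have h1 : ∑ t, C t b c * T t = k * ((∑ t, h t b * T t) * τ c + (∑ t, h t c * T t) * τ b
        + h b c * ∑ t, τ t * T t - α / β * (τ b * τ c) * ∑ t, τ t * T t) := by
      simp only [Finset.mul_sum, Finset.sum_mul, ← Finset.sum_add_distrib,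
        ← Finset.sum_sub_distrib]
      exact Finset.sum_congr rfl fun t _ => by rw [hC]; ring
    rw [h1, hhT, hhT, hτT]
    field_simp
    ring
  have hprod : ∀ b c d, ∑ t, C t b c * ∑ w, M⁻¹ t w * C a w d =
      k * (C a b c * τ d + C d b c * τ a
        + (h a d / α - τ a * τ d / β) * (k * (α * τ b * τ c + h b c * β))) := by
    intro b c d
    have h1 : ∀ e, ∑ t, C t b c * (1 : Matrix ι ι ℝ) t e = C e b c := fun e => by
      simp [Matrix.one_apply]
    have h2 : ∑ t, C t b c * ∑ w, M⁻¹ t w * C a w d =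
        k * ((∑ t, C t b c * (1 : Matrix ι ι ℝ) t a - (∑ t, C t b c * X t) * y a / κ) * τ d
          + (∑ t, C t b c * (1 : Matrix ι ι ℝ) t d - (∑ t, C t b c * X t) * y d / κ) * τ a
          + (h a d / α - τ a * τ d / β) * ∑ t, C t b c * T t) := by
      simp only [hup, Finset.mul_sum, Finset.sum_mul, Finset.sum_div,
        ← Finset.sum_add_distrib, ← Finset.sum_sub_distrib]
      exact Finset.sum_congr rfl fun t _ => by ring
    rw [h2, h1, h1, hCX, hCT]
    ring
  rw [Finset.sum_sub_distrib, hprod, hprod]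
  simp only [hC]
  rw [hsymm d b, hsymm c b, hsymm d c]
  field_simp
  ring

variable {n : ℕ} {F : Type*} [NormedAddCommGroup F] [InnerProductSpace ℝ F]
  {r : Matrix (Fin n) (Fin n) ℝ} {g : ℝ} {ρ : (Fin (n + 1) → ℝ) →L[ℝ] F} {R : Fin (n + 1) → ℝ}

theorem sum_apply_single_mul {ι : Type*} [Fintype ι] [DecidableEq ι] (L : (ι → ℝ) →L[ℝ] ℝ)
    (a : ι → ℝ) : ∑ s, L (Pi.single s 1) * a s = L a := by
  conv_rhs => rw [pi_eq_sum_univ' a]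
  simp [map_sum, mul_comm]

/-- The metric tensor as a bilinear form, off the axis: `J² (E + (τ ⊗ τ + w ⊗ w) / B)`. -/
def metricForm (r : Matrix (Fin n) (Fin n) ℝ) (g : ℝ) (ρ : (Fin (n + 1) → ℝ) →L[ℝ] F)
    (R x : Fin (n + 1) → ℝ) : (Fin (n + 1) → ℝ) →L[ℝ] ℝ :=
  J r g R ^ 2 • ((innerSL ℝ (ρ x)).comp ρ - (spatial ρ R x / q r R ^ 2) • spatial ρ R +
    ((angleForm r ρ R x / B r g R) • angleForm r ρ R +
      (radialForm r g ρ R x / B r g R) • radialForm r g ρ R))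

theorem metricForm_apply (x y : Fin (n + 1) → ℝ) : metricForm r g ρ R x y =
    J r g R ^ 2 * (⟪ρ x, ρ y⟫ - spatial ρ R x * spatial ρ R y / q r R ^ 2 +
      (angleForm r ρ R x * angleForm r ρ R y + radialForm r g ρ R x * radialForm r g ρ R y)
        / B r g R) := by
  simp only [metricForm, smul_apply, add_apply, sub_apply, smul_eq_mul,
    ContinuousLinearMap.comp_apply, innerSL_apply_apply]
  ring

theorem metricForm_comm (x y : Fin (n + 1) → ℝ) :
    metricForm r g ρ R x y = metricForm r g ρ R y x := by
  rw [metricForm_apply, metricForm_apply, real_inner_comm]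
  ring

namespace IsSpatialFrame

theorem metric_eq_metricForm (hg₁ : -2 < g) (hg₂ : g < 2) (hρ : IsSpatialFrame r ρ)
    (hq : q r R ≠ 0) (s t : Fin (n + 1)) :
    metric r g R s t = metricForm r g ρ R (Pi.single s 1) (Pi.single t 1) := by
  rw [hρ.metric_eq hg₁ hg₂ hq, metricForm_apply]

theorem metric_mulVec (hg₁ : -2 < g) (hg₂ : g < 2) (hρ : IsSpatialFrame r ρ)
    (hq : q r R ≠ 0) (x : Fin (n + 1) → ℝ) (s : Fin (n + 1)) :
    (metric r g R).mulVec x s = metricForm r g ρ R (Pi.single s 1) x := by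
  simp only [Matrix.mulVec, dotProduct, hρ.metric_eq_metricForm hg₁ hg₂ hq]
  exact sum_apply_single_mul _ _

theorem sum_metric_mul_mul (hg₁ : -2 < g) (hg₂ : g < 2) (hρ : IsSpatialFrame r ρ)
    (hq : q r R ≠ 0) (x y : Fin (n + 1) → ℝ) :
    ∑ s, ∑ t, metric r g R s t * x s * y t = metricForm r g ρ R x y := by
  rw [metricForm_comm, ← sum_apply_single_mul]
  refine Finset.sum_congr rfl fun s _ => ?_
  rw [metricForm_comm, ← hρ.metric_mulVec hg₁ hg₂ hq, Matrix.mulVec, dotProduct, Finset.sum_mul]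
  exact Finset.sum_congr rfl fun t _ => by ring

theorem eq_zero (hr : r.PosDef) (hρ : IsSpatialFrame r ρ) {x : Fin (n + 1) → ℝ}
    (h1 : ρ x = 0) (h2 : axial x = 0) : x = 0 := by
  have h3 : (fun a : Fin n => x a.castSucc) = 0 := by
    by_contra hne
    have h4 := hr.dotProduct_mulVec_pos hne
    have h5 := hρ x x
    rw [h1, inner_zero_left] at h5
    refine h4.ne' ?_
    rw [h5]
    simp only [dotProduct, Matrix.mulVec, star_trivial, Finset.mul_sum]
    exact Finset.sum_congr rfl fun a _ => Finset.sum_congr rfl fun b _ => by ring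
  funext i
  refine Fin.lastCases h2 (fun a => congrFun h3 a) i

theorem metricForm_self_pos (hg₁ : -2 < g) (hg₂ : g < 2) (hr : r.PosDef)
    (hρ : IsSpatialFrame r ρ) (hq : q r R ≠ 0) {x : Fin (n + 1) → ℝ} (hx : x ≠ 0) :
    0 < metricForm r g ρ R x x := by
  have hB := B_pos_of_q_ne_zero hg₁ hg₂ hq
  have hq2 : 0 < q r R ^ 2 := by positivity
  have hJ : 0 < J r g R ^ 2 := pow_pos J_pos 2
  -- Cauchy–Schwarz: `E` is positive semidefinite
  have hE : 0 ≤ ⟪ρ x, ρ x⟫ - spatial ρ R x * spatial ρ R x / q r R ^ 2 := by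
    rw [sub_nonneg, div_le_iff₀ hq2, ← hρ.inner_self, spatial_apply, mul_comm]
    nlinarith [real_inner_mul_inner_self_le (ρ R) (ρ x)]
  rw [metricForm_apply]
  refine mul_pos hJ ?_
  by_contra! hle
  have hsq : 0 ≤ (angleForm r ρ R x * angleForm r ρ R x +
      radialForm r g ρ R x * radialForm r g ρ R x) / B r g R :=
    div_nonneg (add_nonneg (mul_self_nonneg _) (mul_self_nonneg _)) hB.le
  have h0 : angleForm r ρ R x * angleForm r ρ R x +
      radialForm r g ρ R x * radialForm r g ρ R x = 0 := by
    have h1 := le_antisymm (by linarith) hsq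
    exact (div_eq_zero_iff.1 h1).resolve_right hB.ne'
  have hτ : angleForm r ρ R x = 0 := by
    nlinarith [mul_self_nonneg (angleForm r ρ R x), mul_self_nonneg (radialForm r g ρ R x)]
  have hw : radialForm r g ρ R x = 0 := by
    nlinarith [mul_self_nonneg (angleForm r ρ R x), mul_self_nonneg (radialForm r g ρ R x)]
  -- `τ` and `w` are linearly independent combinations of `v` and `dZ`
  have hv : spatial ρ R x = 0 := by
    have h1 : B r g R * spatial ρ R x = 0 := by
      have h2 : q r R * angleForm r ρ R x = q r R ^ 2 * axial x - axial R * spatial ρ R x := by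
        rw [angleForm_apply, spatial_apply]
        field_simp
      rw [radialForm_apply, ← spatial_apply] at hw
      rw [hτ] at h2
      rw [B]
      linear_combination q r R ^ 2 * hw + (axial R + g * q r R) * h2
    exact (mul_eq_zero.1 h1).resolve_left hB.ne'
  have hz : axial x = 0 := by
    rw [angleForm_apply, ← spatial_apply, hv, mul_zero, sub_zero] at hτ
    exact (mul_eq_zero.1 hτ).resolve_left hq
  have hρx : ρ x = 0 := by
    rw [hv, h0] at hle
    simp only [mul_zero, zero_div, sub_zero, add_zero] at hle
    exact real_inner_self_nonpos.1 hle
  exact hx (hρ.eq_zero hr hρx hz)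

theorem metric_posDef (hg₁ : -2 < g) (hg₂ : g < 2) (hr : r.PosDef)
    (hρ : IsSpatialFrame r ρ) (hq : q r R ≠ 0) : (metric r g R).PosDef := by
  refine Matrix.PosDef.of_dotProduct_mulVec_pos ?_ fun x hx => ?_
  · ext s t
    simp [hρ.metric_eq_metricForm hg₁ hg₂ hq, metricForm_comm]
  · have h := hρ.metricForm_self_pos hg₁ hg₂ hr hq hx
    rw [← hρ.sum_metric_mul_mul hg₁ hg₂ hq] at h
    refine h.trans_eq ?_
    simp only [star_trivial, dotProduct, Matrix.mulVec, Finset.mul_sum]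
    exact Finset.sum_congr rfl fun s _ => Finset.sum_congr rfl fun t _ => by ring

theorem angular_eq (hg₁ : -2 < g) (hg₂ : g < 2) (hρ : IsSpatialFrame r ρ) (hq : q r R ≠ 0)
    (s t : Fin (n + 1)) : angular r g s t R = J r g R ^ 2 *
      (⟪ρ (Pi.single s 1), ρ (Pi.single t 1)⟫
        - spatial ρ R (Pi.single s 1) * spatial ρ R (Pi.single t 1) / q r R ^ 2
        + angleForm r ρ R (Pi.single s 1) * angleForm r ρ R (Pi.single t 1) / B r g R) := by
  have hB := B_pos_of_q_ne_zero hg₁ hg₂ hq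
  have hJ : J r g R ≠ 0 := J_pos.ne'
  rw [angular, hρ.metric_eq hg₁ hg₂ hq, hρ.lower_eq hg₁ hg₂ hq, hρ.lower_eq hg₁ hg₂ hq,
    K_sq hB.le]
  have := hB.ne'
  field_simp
  ring

theorem radialForm_self (hρ : IsSpatialFrame r ρ) : radialForm r g ρ R R = B r g R := by
  rw [radialForm_apply, hρ.inner_self, B]
  ring

theorem angleForm_self (hρ : IsSpatialFrame r ρ) : angleForm r ρ R R = 0 := by
  rw [angleForm_apply, hρ.inner_self]
  field_simp
  ring

/-- The vector whose index-lowered form is proportional to `τ`. -/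
theorem exists_raised_angleForm (hg₁ : -2 < g) (hg₂ : g < 2) (hρ : IsSpatialFrame r ρ)
    (hq : q r R ≠ 0) : ∃ T : Fin (n + 1) → ℝ, radialForm r g ρ R T = 0 ∧
      angleForm r ρ R T = B r g R ∧
      ∀ x, metricForm r g ρ R x T = J r g R ^ 2 * angleForm r ρ R x := by
  have hB := (B_pos_of_q_ne_zero hg₁ hg₂ hq).ne'
  set e : Fin (n + 1) → ℝ := Pi.single (Fin.last n) 1
  have he : ρ e = 0 := by
    rw [← inner_self_eq_zero (𝕜 := ℝ), hρ]
    simp [e, (Fin.castSucc_lt_last _).ne]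
  have hae : axial e = 1 := by simp [axial, e]
  -- `T` is spanned by `R` and the axis; `α` is chosen so that `w` vanishes on it
  set α := -((axial R + g * q r R) / q r R) with hα
  set T : Fin (n + 1) → ℝ := α • R + (q r R - α * axial R) • e with hT
  have hρT : ρ T = α • ρ R := by simp [hT, he]
  have haT : axial T = q r R := by
    have : axial T = α * axial R + (q r R - α * axial R) * axial e := rfl
    rw [this, hae]
    ring
  have hw : radialForm r g ρ R T = 0 := by
    rw [radialForm_apply, hρT, haT, real_inner_smul_right, hρ.inner_self, hα]
    field_simp
    ring
  have hτ : angleForm r ρ R T = B r g R := by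
    rw [angleForm_apply, hρT, haT, real_inner_smul_right, hρ.inner_self, hα, B]
    field_simp
    ring
  refine ⟨T, hw, hτ, fun x => ?_⟩
  rw [metricForm_apply, hw, hτ, spatial_apply T, hρT, real_inner_smul_right,
    real_inner_smul_right, hρ.inner_self, spatial_apply, real_inner_comm]
  field_simp
  ring

theorem curvatureS_eq (hg₁ : -2 < g) (hg₂ : g < 2) (hr : r.PosDef) (hρ : IsSpatialFrame r ρ)
    (hq : q r R ≠ 0) (a b c d : Fin (n + 1)) :
    curvatureS r g a b c d R = -(g ^ 2 / 4) *
      (angular r g a c R * angular r g b d R - angular r g a d R * angular r g b c R)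
        / K r g R ^ 2 := by
  have hBpos := B_pos_of_q_ne_zero hg₁ hg₂ hq
  have hB := hBpos.ne'
  have hJ : J r g R ≠ 0 := J_pos.ne'
  obtain ⟨T, hwT, hτT, hT⟩ := hρ.exists_raised_angleForm hg₁ hg₂ hq
  have hlow : ∀ s, metricForm r g ρ R (Pi.single s 1) R = lower r g s R := by
    intro s
    rw [metricForm_apply, hρ.angleForm_self, hρ.radialForm_self, hρ.lower_eq hg₁ hg₂ hq,
      spatial_apply R, hρ.inner_self, spatial_apply, real_inner_comm]
    field_simp
    ring
  have hylin : ∀ x, ∑ t, lower r g t R * x t = J r g R ^ 2 * radialForm r g ρ R x := by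
    intro x
    rw [← sum_apply_single_mul, Finset.mul_sum]
    exact Finset.sum_congr rfl fun t _ => by rw [hρ.lower_eq hg₁ hg₂ hq]; ring
  have key := sum_cartan_mul_cartanUp (M := metric r g R)
    (h := fun s t => angular r g s t R) (C := fun s t u => cartan r g s t u R)
    (y := fun s => lower r g s R) (τ := fun s => angleForm r ρ R (Pi.single s 1)) (X := R) (T := T)
    (k := g / (2 * B r g R)) (α := J r g R ^ 2) (β := B r g R) (κ := K r g R ^ 2)
    (hρ.metric_posDef hg₁ hg₂ hr hq).det_pos.ne'.isUnit (pow_ne_zero 2 hJ) hB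
    (fun s t => rfl)
    (fun s t => by
      rw [hρ.angular_eq hg₁ hg₂ hq, hρ.angular_eq hg₁ hg₂ hq, real_inner_comm]
      ring)
    (funext fun s => by rw [hρ.metric_mulVec hg₁ hg₂ hq, hlow])
    (fun s => by
      have h1 : ∑ t, angular r g s t R * R t = (metric r g R).mulVec R s -
          lower r g s R / K r g R ^ 2 * ∑ t, lower r g t R * R t := by
        rw [Matrix.mulVec, dotProduct, Finset.mul_sum, ← Finset.sum_sub_distrib]
        exact Finset.sum_congr rfl fun t _ => by rw [angular]; ring
      rw [h1, hρ.metric_mulVec hg₁ hg₂ hq, hlow, hylin, hρ.radialForm_self, K_sq hBpos.le]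
      field_simp
      ring)
    (funext fun s => by rw [hρ.metric_mulVec hg₁ hg₂ hq, hT])
    (by rw [hylin, hwT, mul_zero])
    (by rw [sum_apply_single_mul, hρ.angleForm_self])
    (by rw [sum_apply_single_mul, hτT])
    (fun s t u => by
      rw [hρ.cartan_eq hg₁ hg₂ hq, hρ.angular_eq hg₁ hg₂ hq, hρ.angular_eq hg₁ hg₂ hq,
        hρ.angular_eq hg₁ hg₂ hq]
      field_simp
      ring)
    a b c d
  simp only [curvatureS, cartanUp]
  rw [key, K_sq hBpos.le]
  field_simp
  ring

end IsSpatialFrame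

end Curvature

/-! ### Smoothness off the axis -/

section Smooth

variable {n : ℕ} {F : Type*} [NormedAddCommGroup F] [InnerProductSpace ℝ F]
  {r : Matrix (Fin n) (Fin n) ℝ} {g : ℝ} {ρ : (Fin (n + 1) → ℝ) →L[ℝ] F} {R : Fin (n + 1) → ℝ}

theorem contDiff_axial : ContDiff ℝ ∞ (axial (n := n)) := (axialL (n := n)).contDiff

namespace IsSpatialFrame

theorem contDiffAt_q (hρ : IsSpatialFrame r ρ) (hq : q r R ≠ 0) : ContDiffAt ℝ ∞ (q r) R := by
  rw [show q r = fun R => ‖ρ R‖ from funext fun R => hρ.q_eq_norm]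
  exact ρ.contDiff.contDiffAt.norm ℝ (norm_ne_zero_iff.1 (hρ.q_eq_norm ▸ hq))

theorem contDiffAt_A (hρ : IsSpatialFrame r ρ) (hq : q r R ≠ 0) : ContDiffAt ℝ ∞ (A r g) R :=
  contDiff_axial.contDiffAt.add (contDiffAt_const.mul (hρ.contDiffAt_q hq))

theorem contDiffAt_J (hg₁ : -2 < g) (hg₂ : g < 2) (hρ : IsSpatialFrame r ρ) (hq : q r R ≠ 0) :
    ContDiffAt ℝ ∞ (J r g) R := by
  have h : ContDiffAt ℝ ∞ (Phi r g) R :=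
    ((hρ.contDiffAt_A hq).div (contDiffAt_const.mul (hρ.contDiffAt_q hq))
      (mul_ne_zero (hPar_pos hg₁ hg₂).ne' hq)).arctan.congr_of_eventuallyEq
        (hρ.Phi_eventuallyEq hq)
  exact (contDiffAt_const.mul h).exp

theorem contDiffAt_K (hg₁ : -2 < g) (hg₂ : g < 2) (hρ : IsSpatialFrame r ρ) (hq : q r R ≠ 0) :
    ContDiffAt ℝ ∞ (K r g) R := by
  have hB : ContDiffAt ℝ ∞ (B r g) R :=
    (((contDiff_axial.contDiffAt).pow 2).add
      ((contDiffAt_const.mul (hρ.contDiffAt_q hq)).mul contDiff_axial.contDiffAt)).add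
        ((hρ.contDiffAt_q hq).pow 2)
  exact (hB.sqrt (B_pos_of_q_ne_zero hg₁ hg₂ hq).ne').mul (hρ.contDiffAt_J hg₁ hg₂ hq)

end IsSpatialFrame

end Smooth

/-! ### The Euclidean case -/

section Euclidean

variable {n : ℕ} {F : Type*} [NormedAddCommGroup F] [InnerProductSpace ℝ F]
  {r : Matrix (Fin n) (Fin n) ℝ} {ρ : (Fin (n + 1) → ℝ) →L[ℝ] F} {R : Fin (n + 1) → ℝ}

theorem J_zero : J r 0 R = 1 := by simp [J, GPar]

theorem hPar_zero : hPar 0 = 1 := by simp [hPar]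

namespace IsSpatialFrame

theorem B_zero (hρ : IsSpatialFrame r ρ) : B r 0 R = ⟪ρ R, ρ R⟫ + axial R ^ 2 := by
  rw [B, hρ.inner_self]
  ring

theorem B_zero_pos (hr : r.PosDef) (hρ : IsSpatialFrame r ρ) (hR : R ≠ 0) : 0 < B r 0 R := by
  rw [hρ.B_zero]
  by_cases h : ρ R = 0
  · have : axial R ≠ 0 := fun h2 => hR (hρ.eq_zero hr h h2)
    have : 0 ≤ ⟪ρ R, ρ R⟫ := real_inner_self_nonneg
    positivity
  · have := real_inner_self_pos.2 h
    positivity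

theorem K_sq_zero (hρ : IsSpatialFrame r ρ) : K r 0 R ^ 2 = ⟪ρ R, ρ R⟫ + axial R ^ 2 := by
  have h0 : 0 ≤ ⟪ρ R, ρ R⟫ := real_inner_self_nonneg
  rw [K_sq, J_zero, hρ.B_zero]
  · ring
  · rw [hρ.B_zero]
    positivity

theorem lower_zero (hρ : IsSpatialFrame r ρ) (s : Fin (n + 1)) :
    lower r 0 s R = ⟪ρ R, ρ (Pi.single s 1)⟫ + axial R * axial (n := n) (Pi.single s 1) := by
  have hK : (fun X => K r 0 X ^ 2) = fun X => ⟪ρ X, ρ X⟫ + axial X ^ 2 :=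
    funext fun X => hρ.K_sq_zero
  have h1 := ((ρ.hasFDerivAt (x := R)).inner ℝ (ρ.hasFDerivAt (x := R))).add
    (hasFDerivAt_axial.pow 2) |>.fderiv
  rw [lower, pd, hK]
  refine (congrArg (fun L : (Fin (n + 1) → ℝ) →L[ℝ] ℝ => 1 / 2 * L (Pi.single s 1)) h1).trans ?_
  simp only [add_apply, smul_apply, smul_eq_mul, nsmul_eq_mul, ContinuousLinearMap.comp_apply,
    ContinuousLinearMap.prod_apply, fderivInnerCLM_apply, axialL_apply]
  rw [real_inner_comm (ρ R)]
  push_cast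
  ring

theorem metric_zero (hρ : IsSpatialFrame r ρ) (s t : Fin (n + 1)) :
    metric r 0 R s t = ⟪ρ (Pi.single s 1), ρ (Pi.single t 1)⟫ +
      axial (n := n) (Pi.single s 1) * axial (n := n) (Pi.single t 1) := by
  have h1 := ((hasFDerivAt_spatial (ρ := ρ) (R := R) (Pi.single s 1)).add
    ((hasFDerivAt_axial (R := R)).mul_const (axial (n := n) (Pi.single s 1)))).fderiv
  have h2 : lower r 0 s = fun X => ⟪ρ X, ρ (Pi.single s 1)⟫ +
      axial X * axial (n := n) (Pi.single s 1) := funext fun X => hρ.lower_zero s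
  rw [metric, Matrix.of_apply, pd, h2]
  exact congrArg (fun L : (Fin (n + 1) → ℝ) →L[ℝ] ℝ => L (Pi.single t 1)) h1

theorem cartan_zero (hρ : IsSpatialFrame r ρ) (s t u : Fin (n + 1)) :
    cartan r 0 s t u R = 0 := by
  simp [cartan, pd, hρ.metric_zero]

theorem sum_metric_zero_mul_mul (hρ : IsSpatialFrame r ρ) (x y : Fin (n + 1) → ℝ) :
    ∑ s, ∑ t, metric r 0 R s t * x s * y t = ⟪ρ x, ρ y⟫ + axial x * axial y := by
  have h1 : ∀ s, ∑ t, metric r 0 R s t * x s * y t =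
      (⟪ρ y, ρ (Pi.single s 1)⟫ + axial y * axial (n := n) (Pi.single s 1)) * x s := by
    intro s
    have := sum_apply_single_mul ((innerSL ℝ (ρ (Pi.single s 1))).comp ρ +
      axial (n := n) (Pi.single s 1) • axialL) y
    simp only [add_apply, smul_apply, smul_eq_mul, ContinuousLinearMap.comp_apply,
      innerSL_apply_apply, axialL_apply] at this
    rw [real_inner_comm, mul_comm (axial y), ← this, Finset.sum_mul]
    exact Finset.sum_congr rfl fun t _ => by rw [hρ.metric_zero]; ring
  simp only [h1]
  have := sum_apply_single_mul ((innerSL ℝ (ρ y)).comp ρ + axial y • axialL) x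
  simp only [add_apply, smul_apply, smul_eq_mul, ContinuousLinearMap.comp_apply,
    innerSL_apply_apply, axialL_apply] at this
  rw [this, real_inner_comm]
  ring

theorem metric_zero_posDef (hr : r.PosDef) (hρ : IsSpatialFrame r ρ) :
    (metric r 0 R).PosDef := by
  refine Matrix.PosDef.of_dotProduct_mulVec_pos ?_ fun x hx => ?_
  · ext s t
    simp [hρ.metric_zero, real_inner_comm, mul_comm]
  · have h := hρ.B_zero_pos hr hx
    rw [hρ.B_zero, sq, ← hρ.sum_metric_zero_mul_mul (R := R)] at h
    refine h.trans_eq ?_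
    simp only [star_trivial, dotProduct, Matrix.mulVec, Finset.mul_sum]
    exact Finset.sum_congr rfl fun s _ => Finset.sum_congr rfl fun t _ => by ring

theorem contDiffAt_K_zero (hr : r.PosDef) (hρ : IsSpatialFrame r ρ) (hR : R ≠ 0) :
    ContDiffAt ℝ ∞ (K r 0) R := by
  have hK : K r 0 = fun X => √(⟪ρ X, ρ X⟫ + axial X ^ 2) := funext fun X => by
    rw [K, J_zero, hρ.B_zero, mul_one]
  rw [hK]
  refine ContDiffAt.sqrt ?_ (by rw [← hρ.B_zero]; exact (hρ.B_zero_pos hr hR).ne')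
  exact ((ρ.contDiff.inner ℝ ρ.contDiff).add (contDiff_axial.pow 2)).contDiffAt

end IsSpatialFrame

end Euclidean

/-! ### The quasi-Euclidean map -/

section SphereMap

variable {n : ℕ} {E : Type*} [NormedAddCommGroup E] [InnerProductSpace ℝ E]
  {r : Matrix (Fin n) (Fin n) ℝ} {g : ℝ} {T : (Fin (n + 1) → ℝ) ≃L[ℝ] E} {R : Fin (n + 1) → ℝ}

/-- The linear isomorphism `T` is an isometry for the Euclidean metric `r ⊕ 1`. -/
def IsFrame (r : Matrix (Fin n) (Fin n) ℝ) (T : (Fin (n + 1) → ℝ) ≃L[ℝ] E) : Prop :=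
  ∀ x y, ⟪T x, T y⟫ = (∑ a : Fin n, ∑ b : Fin n, r a b * x a.castSucc * y b.castSucc) +
    axial x * axial y

theorem exists_isometry_of_posDef {ι : Type*} [Fintype ι] [DecidableEq ι] {M : Matrix ι ι ℝ}
    (hM : M.PosDef) : ∃ T : (ι → ℝ) ≃L[ℝ] EuclideanSpace ℝ ι,
      ∀ x y, ⟪T x, T y⟫ = x ⬝ᵥ M.mulVec y := by
  open scoped MatrixOrder in
  obtain ⟨b, hb⟩ := CStarAlgebra.nonneg_iff_eq_star_mul_self.mp hM.posSemidef.nonneg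
  let T₀ : (ι → ℝ) →ₗ[ℝ] EuclideanSpace ℝ ι :=
    (WithLp.linearEquiv 2 ℝ (ι → ℝ)).symm.toLinearMap ∘ₗ b.mulVecLin
  have hT₀ : ∀ x y, ⟪T₀ x, T₀ y⟫ = x ⬝ᵥ M.mulVec y := by
    intro x y
    have h1 : ⟪T₀ x, T₀ y⟫ = b.mulVec x ⬝ᵥ b.mulVec y := by
      rw [EuclideanSpace.inner_eq_star_dotProduct, dotProduct_comm]
      rfl
    rw [h1, hb, ← Matrix.mulVec_mulVec, Matrix.dotProduct_mulVec _ (star b),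
      Matrix.star_eq_conjTranspose, Matrix.conjTranspose_eq_transpose_of_trivial,
      Matrix.vecMul_transpose]
  have hinj : Function.Injective T₀ := by
    rw [injective_iff_map_eq_zero]
    intro x hx
    by_contra hne
    have h1 := hM.dotProduct_mulVec_pos hne
    rw [star_trivial, ← hT₀, hx, inner_zero_left] at h1
    exact h1.false
  exact ⟨(LinearEquiv.ofInjectiveOfFinrankEq T₀ hinj (by simp)).toContinuousLinearEquiv, hT₀⟩

theorem exists_isFrame (hr : r.PosDef) :
    ∃ T : (Fin (n + 1) → ℝ) ≃L[ℝ] EuclideanSpace ℝ (Fin (n + 1)), IsFrame r T := by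
  -- the block matrix `r ⊕ 1`
  let M : Matrix (Fin (n + 1)) (Fin (n + 1)) ℝ := Matrix.of fun i j =>
    Fin.lastCases (motive := fun _ => ℝ) (Fin.lastCases (motive := fun _ => ℝ) 1 (fun _ => 0) j)
      (fun a => Fin.lastCases (motive := fun _ => ℝ) 0 (r a) j) i
  have hquad : ∀ x y : Fin (n + 1) → ℝ, x ⬝ᵥ M.mulVec y =
      (fun a => x a.castSucc) ⬝ᵥ r.mulVec (fun a => y a.castSucc) + axial x * axial y := by
    intro x y
    simp [dotProduct, Matrix.mulVec, M, Fin.sum_univ_castSucc, axial]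
  have hM : M.PosDef := by
    refine Matrix.PosDef.of_dotProduct_mulVec_pos ?_ fun x hx => ?_
    · ext i j
      refine Fin.lastCases ?_ (fun a => ?_) i <;> refine Fin.lastCases ?_ (fun b => ?_) j <;>
        simp [M]
      simpa using hr.isHermitian.apply a b
    · rw [star_trivial, hquad]
      by_cases h : (fun a : Fin n => x a.castSucc) = 0
      · have h2 : axial x ≠ 0 := fun h2 =>
          hx (funext fun i => Fin.lastCases h2 (fun a => congrFun h a) i)
        rw [h, zero_dotProduct, zero_add]
        exact mul_self_pos.2 h2
      · have h1 := hr.dotProduct_mulVec_pos h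
        rw [star_trivial] at h1
        exact add_pos_of_pos_of_nonneg h1 (mul_self_nonneg _)
  obtain ⟨T, hT⟩ := exists_isometry_of_posDef hM
  refine ⟨T, fun x y => ?_⟩
  rw [hT, hquad]
  simp only [dotProduct, Matrix.mulVec, Finset.mul_sum]
  congr 1
  exact Finset.sum_congr rfl fun a _ => Finset.sum_congr rfl fun b _ => by ring

/-- The image under `T` of the unit vector of the `Z`-axis. -/
def pole (T : (Fin (n + 1) → ℝ) ≃L[ℝ] E) : E := T (Pi.single (Fin.last n) 1)

/-- The component of `T x` orthogonal to the axis. -/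
def spatialPart (T : (Fin (n + 1) → ℝ) ≃L[ℝ] E) : (Fin (n + 1) → ℝ) →L[ℝ] E :=
  (T : (Fin (n + 1) → ℝ) →L[ℝ] E) - axialL.smulRight (pole T)

theorem spatialPart_apply (x : Fin (n + 1) → ℝ) : spatialPart T x = T x - axial x • pole T := rfl

theorem apply_eq_spatialPart_add (x : Fin (n + 1) → ℝ) :
    T x = spatialPart T x + axial x • pole T := by
  rw [spatialPart_apply, sub_add_cancel]

namespace IsFrame

theorem inner_pole (hT : IsFrame r T) (x : Fin (n + 1) → ℝ) : ⟪T x, pole T⟫ = axial x := by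
  rw [pole, hT]
  simp [axial]

theorem inner_pole_pole (hT : IsFrame r T) : ⟪pole T, pole T⟫ = (1 : ℝ) := by
  have h := hT.inner_pole (Pi.single (Fin.last n) 1)
  rwa [axial, Pi.single_eq_same] at h

theorem inner_spatialPart_pole (hT : IsFrame r T) (x : Fin (n + 1) → ℝ) :
    ⟪spatialPart T x, pole T⟫ = 0 := by
  rw [spatialPart_apply, inner_sub_left, hT.inner_pole, real_inner_smul_left, hT.inner_pole_pole]
  ring

theorem isSpatialFrame (hT : IsFrame r T) : IsSpatialFrame r (spatialPart T) := by
  intro x y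
  have h := hT x y
  rw [apply_eq_spatialPart_add x, apply_eq_spatialPart_add y] at h
  have h1 : ⟪pole T, spatialPart T y⟫ = 0 := by
    rw [real_inner_comm, hT.inner_spatialPart_pole]
  simp only [inner_add_left, inner_add_right, real_inner_smul_left, real_inner_smul_right,
    hT.inner_spatialPart_pole, h1, hT.inner_pole_pole] at h
  linarith

end IsFrame

/-- The map `R ↦ J (h R^a, A)`, in orthonormal coordinates. It carries `K` to the Euclidean norm,
and hence the indicatrix to the unit sphere. -/
def sphereMap (r : Matrix (Fin n) (Fin n) ℝ) (g : ℝ) (T : (Fin (n + 1) → ℝ) ≃L[ℝ] E)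
    (R : Fin (n + 1) → ℝ) : E :=
  (J r g R * hPar g) • spatialPart T R + (J r g R * A r g R) • pole T

theorem sphereMap_zero : sphereMap r 0 T = T := by
  funext R
  rw [sphereMap, J_zero, hPar_zero, A, apply_eq_spatialPart_add]
  simp

theorem IsFrame.inner_smul_add (hT : IsFrame r T) (x y : Fin (n + 1) → ℝ) (a b c d s t : ℝ) :
    ⟪a • spatialPart T x + b • spatialPart T R + c • pole T,
      s • spatialPart T y + t • spatialPart T R + d • pole T⟫ =
    a * s * ⟪spatialPart T x, spatialPart T y⟫ + a * t * spatial (spatialPart T) R x +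
      b * s * spatial (spatialPart T) R y + b * t * q r R ^ 2 + c * d := by
  have h1 : ∀ x, ⟪pole T, spatialPart T x⟫ = 0 := fun x => by
    rw [real_inner_comm, hT.inner_spatialPart_pole]
  simp only [inner_add_left, inner_add_right, real_inner_smul_left, real_inner_smul_right,
    hT.inner_spatialPart_pole, h1, hT.inner_pole_pole, spatial_apply, hT.isSpatialFrame.inner_self]
  rw [real_inner_comm (spatialPart T R) (spatialPart T x)]
  ring

theorem IsFrame.inner_sphereMap_self (hg₁ : -2 < g) (hg₂ : g < 2) (hT : IsFrame r T) :
    ⟪sphereMap r g T R, sphereMap r g T R⟫ = J r g R ^ 2 * B r g R := by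
  have h := hT.inner_smul_add (R := R) 0 0 0 (J r g R * hPar g) (J r g R * A r g R)
    (J r g R * A r g R) 0 (J r g R * hPar g)
  simp only [zero_smul, zero_add, zero_mul] at h
  rw [sphereMap, h, B_eq_sq_add_sq hg₁ hg₂]
  ring

theorem IsFrame.contDiffAt_sphereMap (hg₁ : -2 < g) (hg₂ : g < 2) (hT : IsFrame r T)
    (hR : R ∈ regularSet r g) : ContDiffAt ℝ ∞ (sphereMap r g T) R := by
  rcases hR with hq | ⟨rfl, -⟩
  · have hJ := hT.isSpatialFrame.contDiffAt_J hg₁ hg₂ hq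
    exact ((hJ.mul contDiffAt_const).smul (spatialPart T).contDiff.contDiffAt).add
      ((hJ.mul (hT.isSpatialFrame.contDiffAt_A hq)).smul contDiffAt_const)
  · rw [sphereMap_zero]
    exact T.contDiff.contDiffAt

theorem IsFrame.fderiv_sphereMap (hg₁ : -2 < g) (hg₂ : g < 2) (hT : IsFrame r T)
    (hq : q r R ≠ 0) (x : Fin (n + 1) → ℝ) : fderiv ℝ (sphereMap r g T) R x =
      (J r g R * hPar g) • spatialPart T x +
        (J r g R * (g / (2 * B r g R)) * angleForm r (spatialPart T) R x * hPar g) •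
          spatialPart T R +
        (J r g R * (axial x + g / (2 * q r R) * spatial (spatialPart T) R x) +
          J r g R * (g / (2 * B r g R)) * angleForm r (spatialPart T) R x * A r g R) •
            pole T := by
  have hJ := hT.isSpatialFrame.hasFDerivAt_J hg₁ hg₂ hq
  have h : HasFDerivAt (sphereMap r g T) _ R :=
    ((hJ.mul_const (hPar g)).smul (spatialPart T).hasFDerivAt).add
      ((hJ.mul (hT.isSpatialFrame.hasFDerivAt_A (g := g) hq)).smul_const (pole T))
  rw [h.fderiv]
  simp only [add_apply, smul_apply, smul_eq_mul, ContinuousLinearMap.smulRight_apply, axialL_apply]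
  congr 3 <;> ring

/-- The metric tensor compared with the pullback of the Euclidean metric: they agree up to the
factor `h²`, except in the radial direction. -/
theorem IsFrame.inner_fderiv_sphereMap (hg₁ : -2 < g) (hg₂ : g < 2) (hT : IsFrame r T)
    (hq : q r R ≠ 0) (x y : Fin (n + 1) → ℝ) :
    ⟪fderiv ℝ (sphereMap r g T) R x, fderiv ℝ (sphereMap r g T) R y⟫ =
      hPar g ^ 2 * metricForm r g (spatialPart T) R x y + (1 - hPar g ^ 2) * (J r g R ^ 2 *
        (radialForm r g (spatialPart T) R x * radialForm r g (spatialPart T) R y) / B r g R) := by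
  have hB := (B_pos_of_q_ne_zero hg₁ hg₂ hq).ne'
  have hh := hPar_sq hg₁ hg₂
  rw [hT.fderiv_sphereMap hg₁ hg₂ hq, hT.fderiv_sphereMap hg₁ hg₂ hq, hT.inner_smul_add,
    metricForm_apply]
  simp only [angleForm_apply, radialForm_apply, ← spatial_apply]
  generalize spatial (spatialPart T) R x = vx
  generalize spatial (spatialPart T) R y = vy
  generalize ⟪spatialPart T x, spatialPart T y⟫ = rxy
  -- all powers of `h` collect to `h²`, which is polynomial in `g`
  have key : ∀ h P Q b₁ b₂ c₁ c₂ e : ℝ, J r g R * h * (J r g R * h) * e +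
      J r g R * h * (b₂ * h) * P + b₁ * h * (J r g R * h) * Q +
      b₁ * h * (b₂ * h) * q r R ^ 2 + c₁ * c₂ =
      h ^ 2 * (J r g R ^ 2 * e + J r g R * b₂ * P + J r g R * b₁ * Q + b₁ * b₂ * q r R ^ 2) +
        c₁ * c₂ := by
    intros
    ring
  rw [key, hh, A]
  field_simp
  rw [B]
  ring

end SphereMap

/-! ### Parametrizations of the indicatrix -/

section Parametrization

variable {n : ℕ} {E : Type*} [NormedAddCommGroup E] [InnerProductSpace ℝ E]
  {r : Matrix (Fin n) (Fin n) ℝ} {g : ℝ} {T : (Fin (n + 1) → ℝ) ≃L[ℝ] E} {R : Fin (n + 1) → ℝ}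

theorem B_nonneg (hg₁ : -2 < g) (hg₂ : g < 2) : 0 ≤ B r g R := by
  rw [B_eq_sq_add_sq hg₁ hg₂]
  positivity

namespace IsFrame

theorem contDiffAt_K (hg₁ : -2 < g) (hg₂ : g < 2) (hr : r.PosDef) (hT : IsFrame r T)
    (hR : R ∈ regularSet r g) : ContDiffAt ℝ ∞ (K r g) R := by
  rcases hR with hq | ⟨rfl, h0⟩
  · exact hT.isSpatialFrame.contDiffAt_K hg₁ hg₂ hq
  · exact hT.isSpatialFrame.contDiffAt_K_zero hr h0

theorem K_pos (hg₁ : -2 < g) (hg₂ : g < 2) (hr : r.PosDef) (hT : IsFrame r T)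
    (hR : R ∈ regularSet r g) : 0 < K r g R := by
  refine mul_pos (Real.sqrt_pos.2 ?_) J_pos
  rcases hR with hq | ⟨rfl, h0⟩
  · exact B_pos_of_q_ne_zero hg₁ hg₂ hq
  · exact hT.isSpatialFrame.B_zero_pos hr h0

theorem metric_posDef (hg₁ : -2 < g) (hg₂ : g < 2) (hr : r.PosDef) (hT : IsFrame r T)
    (hR : R ∈ regularSet r g) : (metric r g R).PosDef := by
  rcases hR with hq | ⟨rfl, -⟩
  · exact hT.isSpatialFrame.metric_posDef hg₁ hg₂ hr hq
  · exact hT.isSpatialFrame.metric_zero_posDef hr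

theorem curvatureS_eq (hg₁ : -2 < g) (hg₂ : g < 2) (hr : r.PosDef) (hT : IsFrame r T)
    (hR : R ∈ regularSet r g) (a b c d : Fin (n + 1)) :
    curvatureS r g a b c d R = -(g ^ 2 / 4) *
      (angular r g a c R * angular r g b d R - angular r g a d R * angular r g b c R)
        / K r g R ^ 2 := by
  rcases hR with hq | ⟨rfl, -⟩
  · exact hT.isSpatialFrame.curvatureS_eq hg₁ hg₂ hr hq a b c d
  · simp [curvatureS, hT.isSpatialFrame.cartan_zero]

/-- In directions tangent to the level sets of `K`, the metric tensor is `h⁻²` times the pullback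
of the Euclidean metric. -/
theorem inner_fderiv_sphereMap_of_tangent (hg₁ : -2 < g) (hg₂ : g < 2) (hT : IsFrame r T)
    (hR : R ∈ regularSet r g) {x : Fin (n + 1) → ℝ}
    (hx : fderiv ℝ (fun X => K r g X ^ 2) R x = 0) (y : Fin (n + 1) → ℝ) :
    ⟪fderiv ℝ (sphereMap r g T) R x, fderiv ℝ (sphereMap r g T) R y⟫ =
      hPar g ^ 2 * ∑ s, ∑ t, metric r g R s t * x s * y t := by
  rcases hR with hq | ⟨rfl, -⟩
  · have hw : radialForm r g (spatialPart T) R x = 0 := by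
      rw [(hT.isSpatialFrame.hasFDerivAt_K_sq hg₁ hg₂ hq).fderiv, smul_apply, smul_eq_mul] at hx
      exact (mul_eq_zero.1 hx).resolve_left (mul_ne_zero two_ne_zero (pow_ne_zero 2 J_pos.ne'))
    rw [hT.inner_fderiv_sphereMap hg₁ hg₂ hq, hT.isSpatialFrame.sum_metric_mul_mul hg₁ hg₂ hq, hw]
    ring
  · rw [sphereMap_zero, hT.isSpatialFrame.sum_metric_zero_mul_mul, hPar_zero, T.fderiv]
    rw [hT.isSpatialFrame, one_pow, one_mul]
    exact hT x y

end IsFrame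

namespace IsParametrization

variable {φ : (Fin n → ℝ) → (Fin (n + 1) → ℝ)} {U : Set (Fin n → ℝ)} {u : Fin n → ℝ}

theorem differentiableAt (hφ : IsParametrization r g φ U) (hu : u ∈ U) :
    DifferentiableAt ℝ φ u :=
  (hφ.smooth.contDiffAt (hφ.isOpen.mem_nhds hu)).differentiableAt (by simp)

theorem fderiv_K_sq (hg₁ : -2 < g) (hg₂ : g < 2) (hr : r.PosDef) (hT : IsFrame r T)
    (hφ : IsParametrization r g φ U) (hu : u ∈ U) (a : Fin n → ℝ) :
    fderiv ℝ (fun X => K r g X ^ 2) (φ u) (fderiv ℝ φ u a) = 0 := by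
  have hK : DifferentiableAt ℝ (fun X => K r g X ^ 2) (φ u) :=
    ((hT.contDiffAt_K hg₁ hg₂ hr (hφ.mem_regular u hu)).pow 2).differentiableAt (by simp)
  have h1 := (hK.hasFDerivAt.comp u (hφ.differentiableAt hu).hasFDerivAt).fderiv
  have h2 : (fun X => K r g X ^ 2) ∘ φ =ᶠ[nhds u] fun _ => 1 :=
    Filter.eventuallyEq_of_mem (hφ.isOpen.mem_nhds hu) fun v hv => by
      have h3 : K r g (φ v) = 1 := hφ.mem_indicatrix v hv
      simp [h3]
  rw [h2.fderiv_eq] at h1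
  have h3 := congrArg (fun L : (Fin n → ℝ) →L[ℝ] ℝ => L a) h1
  simpa using h3.symm

theorem fderiv_smul_sphereMap (hg₁ : -2 < g) (hg₂ : g < 2) (hT : IsFrame r T)
    (hφ : IsParametrization r g φ U) (hu : u ∈ U) (c : ℝ) (a : Fin n → ℝ) :
    fderiv ℝ (fun v => c • sphereMap r g T (φ v)) u a =
      c • fderiv ℝ (sphereMap r g T) (φ u) (fderiv ℝ φ u a) := by
  have h1 : DifferentiableAt ℝ (sphereMap r g T) (φ u) :=
    (hT.contDiffAt_sphereMap hg₁ hg₂ (hφ.mem_regular u hu)).differentiableAt (by simp)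
  have h2 := (h1.hasFDerivAt.comp u (hφ.differentiableAt hu).hasFDerivAt).const_smul c
  exact congrArg (fun L : (Fin n → ℝ) →L[ℝ] E => L a) h2.fderiv

/-- The Finsler metric induced on the indicatrix is that of a Euclidean sphere of radius `1/h`. -/
theorem inducedMetric_eq (hg₁ : -2 < g) (hg₂ : g < 2) (hr : r.PosDef) (hT : IsFrame r T)
    (hφ : IsParametrization r g φ U) (hu : u ∈ U) :
    inducedMetric r g φ u = firstForm (fun v => (hPar g)⁻¹ • sphereMap r g T (φ v)) u := by
  have hh := (hPar_pos hg₁ hg₂).ne'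
  have hpd : ∀ i s, pd i (fun v => φ v s) u = fderiv ℝ φ u (Pi.single i 1) s := fun i s =>
    congrArg (fun L : (Fin n → ℝ) →L[ℝ] ℝ => L (Pi.single i 1))
      (hasFDerivAt_pi'.1 (hφ.differentiableAt hu).hasFDerivAt s).fderiv
  ext i j
  simp only [firstForm, Matrix.of_apply, tangent, inducedMetric, hpd,
    hφ.fderiv_smul_sphereMap hg₁ hg₂ hT hu, real_inner_smul_left, real_inner_smul_right]
  rw [hT.inner_fderiv_sphereMap_of_tangent hg₁ hg₂ (hφ.mem_regular u hu)
    (hφ.fderiv_K_sq hg₁ hg₂ hr hT hu _)]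
  field_simp

theorem isSpherical (hg₁ : -2 < g) (hg₂ : g < 2) (hr : r.PosDef) (hT : IsFrame r T)
    (hφ : IsParametrization r g φ U) :
    IsSpherical (fun v => (hPar g)⁻¹ • sphereMap r g T (φ v)) (hPar g ^ 2) U where
  isOpen := hφ.isOpen
  smooth u hu := by
    refine ContDiffAt.contDiffWithinAt (contDiffAt_const.smul ?_)
    exact (hT.contDiffAt_sphereMap hg₁ hg₂ (hφ.mem_regular u hu)).comp u
      (hφ.smooth.contDiffAt (hφ.isOpen.mem_nhds hu))
  mem_sphere u hu := by
    have hh := (hPar_pos hg₁ hg₂).ne'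
    have hK : K r g (φ u) = 1 := hφ.mem_indicatrix u hu
    rw [real_inner_smul_left, real_inner_smul_right, hT.inner_sphereMap_self hg₁ hg₂,
      mul_comm (_ ^ 2) (B _ _ _), ← K_sq (B_nonneg hg₁ hg₂), hK]
    field_simp
  immersion u hu := by
    have hh := (hPar_pos hg₁ hg₂).ne'
    rw [injective_iff_map_eq_zero]
    intro a ha
    rw [hφ.fderiv_smul_sphereMap hg₁ hg₂ hT hu] at ha
    have h1 := (smul_eq_zero.1 ha).resolve_left (inv_ne_zero hh)
    have h2 := hT.inner_fderiv_sphereMap_of_tangent hg₁ hg₂ (hφ.mem_regular u hu)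
      (hφ.fderiv_K_sq hg₁ hg₂ hr hT hu a) (fderiv ℝ φ u a)
    rw [h1, inner_zero_left, eq_comm, mul_eq_zero] at h2
    have h3 := h2.resolve_left (pow_ne_zero 2 hh)
    by_contra hne
    have h4 : fderiv ℝ φ u a ≠ 0 := fun h0 =>
      hne (hφ.immersion u hu (h0.trans (map_zero _).symm))
    refine ((hT.metric_posDef hg₁ hg₂ hr (hφ.mem_regular u hu)).dotProduct_mulVec_pos h4).ne' ?_
    rw [← h3]
    simp only [star_trivial, dotProduct, Matrix.mulVec, Finset.mul_sum]
    exact Finset.sum_congr rfl fun s _ => Finset.sum_congr rfl fun t _ => by ring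

end IsParametrization

end Parametrization

/-! ### The inverse of the quasi-Euclidean map -/

section Inverse

variable {n : ℕ} {E : Type*} [NormedAddCommGroup E] [InnerProductSpace ℝ E]
  {r : Matrix (Fin n) (Fin n) ℝ} {g : ℝ} {T : (Fin (n + 1) → ℝ) ≃L[ℝ] E} {R : Fin (n + 1) → ℝ}
  {y : E}

/-- Unlike the defining formula of `Φ`, this one needs no case distinction at the axis. -/
theorem Phi_eq_arcsin (hg₁ : -2 < g) (hg₂ : g < 2) (hB : B r g R ≠ 0) :
    Phi r g R = Real.arcsin (A r g R / √(B r g R)) := by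
  have hh := hPar_pos hg₁ hg₂
  rw [Phi]
  split_ifs with hq hZ
  · have h1 : B r g R = A r g R ^ 2 := by rw [B, A, hq]; ring
    have h2 : A r g R = axial R := by rw [A, hq]; ring
    have h3 : axial R ≠ 0 := fun h => hB (by rw [h1, h2, h]; ring)
    rw [h1, h2, Real.sqrt_sq hZ, div_self h3, Real.arcsin_one]
  · have h1 : B r g R = A r g R ^ 2 := by rw [B, A, hq]; ring
    have h2 : A r g R = axial R := by rw [A, hq]; ring
    rw [h1, h2, Real.sqrt_sq_eq_abs, abs_of_neg (not_le.1 hZ), div_neg,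
      div_self (not_le.1 hZ).ne, Real.arcsin_neg, Real.arcsin_one]
  · have hq' : 0 < q r R := lt_of_le_of_ne (Real.sqrt_nonneg _) (Ne.symm hq)
    have h1 : 1 + (A r g R / (hPar g * q r R)) ^ 2 = B r g R / (hPar g * q r R) ^ 2 := by
      rw [B_eq_sq_add_sq hg₁ hg₂]
      field_simp
      ring
    rw [Real.arctan_eq_arcsin, h1, Real.sqrt_div (B_nonneg hg₁ hg₂), Real.sqrt_sq (by positivity)]
    congr 1
    field_simp

/-- The component of `y` orthogonal to the pole. -/
def equatorial (T : (Fin (n + 1) → ℝ) ≃L[ℝ] E) (y : E) : E := y - ⟪y, pole T⟫ • pole T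

/-- The value of `1 / J` at the point of the indicatrix which is mapped to `y`; on the unit sphere
`Φ` is the latitude of `y`. -/
def invJ (g : ℝ) (T : (Fin (n + 1) → ℝ) ≃L[ℝ] E) (y : E) : ℝ :=
  Real.exp (-(1 / 2 * GPar g * Real.arcsin ⟪y, pole T⟫))

/-- The map of the unit sphere to the indicatrix that is inverse to `sphereMap`. -/
def sphereInv (g : ℝ) (T : (Fin (n + 1) → ℝ) ≃L[ℝ] E) (y : E) : Fin (n + 1) → ℝ :=
  T.symm ((invJ g T y / hPar g) • equatorial T y +
    (invJ g T y * (⟪y, pole T⟫ - g / (2 * hPar g) * ‖equatorial T y‖)) • pole T)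

theorem sphereInv_zero : sphereInv 0 T y = T.symm y := by
  simp [sphereInv, invJ, equatorial, hPar_zero, GPar]

theorem continuous_sphereInv : Continuous (sphereInv g T) := by
  have h1 : Continuous fun y : E => ⟪y, pole T⟫ := by fun_prop
  have h2 : Continuous (equatorial T) := continuous_id.sub (h1.smul continuous_const)
  have h3 : Continuous (invJ g T) :=
    Real.continuous_exp.comp (continuous_const.mul (Real.continuous_arcsin.comp h1)).neg
  exact T.symm.continuous.comp (((h3.div_const _).smul h2).add
    ((h3.mul (h1.sub (continuous_const.mul h2.norm))).smul continuous_const))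

namespace IsFrame

theorem inner_equatorial_pole (hT : IsFrame r T) : ⟪equatorial T y, pole T⟫ = (0 : ℝ) := by
  rw [equatorial, inner_sub_left, real_inner_smul_left, hT.inner_pole_pole]
  ring

theorem norm_equatorial_sq (hT : IsFrame r T) (hy : ‖y‖ = 1) :
    ‖equatorial T y‖ ^ 2 = 1 - ⟪y, pole T⟫ ^ 2 := by
  rw [← real_inner_self_eq_norm_sq, equatorial, inner_sub_left, inner_sub_right, inner_sub_right,
    real_inner_smul_left, real_inner_smul_right, real_inner_smul_left, real_inner_smul_right,
    real_inner_self_eq_norm_sq, hy, hT.inner_pole_pole, real_inner_comm (pole T) y,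
    real_inner_comm y (pole T)]
  ring

theorem axial_sphereInv (hT : IsFrame r T) : axial (sphereInv g T y) =
    invJ g T y * (⟪y, pole T⟫ - g / (2 * hPar g) * ‖equatorial T y‖) := by
  rw [← hT.inner_pole, sphereInv, T.apply_symm_apply, inner_add_left, real_inner_smul_left,
    real_inner_smul_left, hT.inner_equatorial_pole, hT.inner_pole_pole]
  ring

theorem spatialPart_sphereInv (hT : IsFrame r T) :
    spatialPart T (sphereInv g T y) = (invJ g T y / hPar g) • equatorial T y := by
  rw [spatialPart_apply, hT.axial_sphereInv, sphereInv, T.apply_symm_apply, add_sub_cancel_right]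

theorem q_sphereInv (hg₁ : -2 < g) (hg₂ : g < 2) (hT : IsFrame r T) :
    q r (sphereInv g T y) = invJ g T y / hPar g * ‖equatorial T y‖ := by
  have h1 : 0 < invJ g T y / hPar g := div_pos (Real.exp_pos _) (hPar_pos hg₁ hg₂)
  rw [hT.isSpatialFrame.q_eq_norm, hT.spatialPart_sphereInv, norm_smul, Real.norm_of_nonneg h1.le]

theorem A_sphereInv (hg₁ : -2 < g) (hg₂ : g < 2) (hT : IsFrame r T) :
    A r g (sphereInv g T y) = invJ g T y * ⟪y, pole T⟫ := by
  have hh := (hPar_pos hg₁ hg₂).ne'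
  rw [A, hT.q_sphereInv hg₁ hg₂, hT.axial_sphereInv]
  field_simp
  ring

theorem B_sphereInv (hg₁ : -2 < g) (hg₂ : g < 2) (hT : IsFrame r T) (hy : ‖y‖ = 1) :
    B r g (sphereInv g T y) = invJ g T y ^ 2 := by
  have hh := (hPar_pos hg₁ hg₂).ne'
  rw [B_eq_sq_add_sq hg₁ hg₂, hT.A_sphereInv hg₁ hg₂, hT.q_sphereInv hg₁ hg₂, ← mul_assoc,
    mul_div_cancel₀ _ hh, mul_pow, mul_pow, hT.norm_equatorial_sq hy]
  ring

theorem J_sphereInv (hg₁ : -2 < g) (hg₂ : g < 2) (hT : IsFrame r T) (hy : ‖y‖ = 1) :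
    J r g (sphereInv g T y) = (invJ g T y)⁻¹ := by
  have h0 : 0 < invJ g T y := Real.exp_pos _
  have hB := hT.B_sphereInv hg₁ hg₂ hy
  rw [J, Phi_eq_arcsin hg₁ hg₂ (by rw [hB]; positivity), hB, Real.sqrt_sq h0.le,
    hT.A_sphereInv hg₁ hg₂, mul_div_cancel_left₀ _ h0.ne', invJ, Real.exp_neg, inv_inv]

theorem sphereInv_mem_indicatrix (hg₁ : -2 < g) (hg₂ : g < 2) (hT : IsFrame r T)
    (hy : ‖y‖ = 1) : sphereInv g T y ∈ indicatrix r g := by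
  have h0 : 0 < invJ g T y := Real.exp_pos _
  change K r g _ = 1
  rw [K, hT.J_sphereInv hg₁ hg₂ hy, hT.B_sphereInv hg₁ hg₂ hy, Real.sqrt_sq h0.le,
    mul_inv_cancel₀ h0.ne']

theorem sphereMap_sphereInv (hg₁ : -2 < g) (hg₂ : g < 2) (hT : IsFrame r T) (hy : ‖y‖ = 1) :
    sphereMap r g T (sphereInv g T y) = y := by
  have h0 : invJ g T y ≠ 0 := (Real.exp_pos _).ne'
  have hh := (hPar_pos hg₁ hg₂).ne'
  rw [sphereMap, hT.J_sphereInv hg₁ hg₂ hy, hT.A_sphereInv hg₁ hg₂, hT.spatialPart_sphereInv,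
    smul_smul, inv_mul_cancel_left₀ h0,
    show (invJ g T y)⁻¹ * hPar g * (invJ g T y / hPar g) = 1 by field_simp, one_smul, equatorial,
    sub_add_cancel]

theorem inner_sphereMap_pole (hT : IsFrame r T) :
    ⟪sphereMap r g T R, pole T⟫ = J r g R * A r g R := by
  rw [sphereMap, inner_add_left, real_inner_smul_left, real_inner_smul_left,
    hT.inner_spatialPart_pole, hT.inner_pole_pole]
  ring

theorem equatorial_sphereMap (hT : IsFrame r T) :
    equatorial T (sphereMap r g T R) = (J r g R * hPar g) • spatialPart T R := by
  rw [equatorial, hT.inner_sphereMap_pole, sphereMap, add_sub_cancel_right]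

theorem norm_sphereMap (hg₁ : -2 < g) (hg₂ : g < 2) (hT : IsFrame r T)
    (hR : R ∈ indicatrix r g) : ‖sphereMap r g T R‖ = 1 := by
  have hK : K r g R = 1 := hR
  have h1 := hT.inner_sphereMap_self (R := R) hg₁ hg₂
  rw [mul_comm, ← K_sq (B_nonneg hg₁ hg₂), hK, real_inner_self_eq_norm_sq] at h1
  nlinarith [norm_nonneg (sphereMap r g T R)]

theorem sphereInv_sphereMap (hg₁ : -2 < g) (hg₂ : g < 2) (hT : IsFrame r T)
    (hR : R ∈ indicatrix r g) : sphereInv g T (sphereMap r g T R) = R := by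
  have hh := hPar_pos hg₁ hg₂
  have hJ : 0 < J r g R := J_pos
  have hK : √(B r g R) * J r g R = 1 := hR
  have hB : B r g R ≠ 0 := fun h => by simp [h] at hK
  have h1 : invJ g T (sphereMap r g T R) = (J r g R)⁻¹ := by
    have h2 : J r g R * A r g R = A r g R / √(B r g R) := by
      rw [eq_inv_of_mul_eq_one_right hK]
      field_simp
    rw [invJ, hT.inner_sphereMap_pole, h2, ← Phi_eq_arcsin hg₁ hg₂ hB, Real.exp_neg, J]
  rw [sphereInv, h1, hT.equatorial_sphereMap, hT.inner_sphereMap_pole, norm_smul,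
    ← hT.isSpatialFrame.q_eq_norm, Real.norm_of_nonneg (by positivity), smul_smul,
    show (J r g R)⁻¹ / hPar g * (J r g R * hPar g) = 1 by field_simp, one_smul,
    show (J r g R)⁻¹ * (J r g R * A r g R - g / (2 * hPar g) * (J r g R * hPar g * q r R)) =
      axial R by rw [A]; field_simp; ring, ← apply_eq_spatialPart_add, T.symm_apply_apply]

theorem contDiffAt_sphereInv (hg₁ : -2 < g) (hg₂ : g < 2) (hT : IsFrame r T) (hy : ‖y‖ = 1)
    (hR : sphereInv g T y ∈ regularSet r g) : ContDiffAt ℝ ∞ (sphereInv g T) y := by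
  rcases hR with hq | ⟨rfl, -⟩
  · have h0 : equatorial T y ≠ 0 := fun h => hq (by rw [hT.q_sphereInv hg₁ hg₂, h]; simp)
    have h1 : ContDiffAt ℝ ∞ (fun y : E => ⟪y, pole T⟫) y :=
      contDiffAt_id.inner ℝ contDiffAt_const
    have h2 : ContDiffAt ℝ ∞ (equatorial T) y := contDiffAt_id.sub (h1.smul contDiffAt_const)
    have h3 : 0 < 1 - ⟪y, pole T⟫ ^ 2 := by
      rw [← hT.norm_equatorial_sq hy]
      have := norm_pos_iff.2 h0
      positivity
    have h4 : ContDiffAt ℝ ∞ (fun y : E => Real.arcsin ⟪y, pole T⟫) y :=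
      (Real.contDiffAt_arcsin (fun h => by rw [h] at h3; norm_num at h3)
        (fun h => by rw [h] at h3; norm_num at h3)).comp y h1
    have h5 : ContDiffAt ℝ ∞ (invJ g T) y := (contDiffAt_const.mul h4).neg.exp
    exact T.symm.contDiff.contDiffAt.comp y (((h5.div_const _).smul h2).add
      ((h5.mul (h1.sub (contDiffAt_const.mul (h2.norm ℝ h0)))).smul contDiffAt_const))
  · rw [show sphereInv 0 T = T.symm from funext fun y => sphereInv_zero]
    exact T.symm.contDiff.contDiffAt

theorem isOpen_preimage_regularSet (hT : IsFrame r T) {X : Type*} [TopologicalSpace X]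
    {φ : X → Fin (n + 1) → ℝ} (hφ : Continuous φ) : IsOpen {u | φ u ∈ regularSet r g} := by
  have h1 : IsOpen {u | q r (φ u) ≠ 0} :=
    isOpen_ne_fun (hT.isSpatialFrame.continuous_q.comp hφ) continuous_const
  have h2 : IsOpen {u | φ u ≠ 0} := isOpen_ne_fun hφ continuous_const
  exact h1.union (isOpen_const.inter h2)

/-- The indicatrix is homeomorphic to the unit sphere. Continuity has to be checked only for the
map from the sphere, because the sphere is compact. -/
def sphereHomeomorph [FiniteDimensional ℝ E] (hg₁ : -2 < g) (hg₂ : g < 2) (hT : IsFrame r T) :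
    Metric.sphere (0 : E) 1 ≃ₜ indicatrix r g :=
  Continuous.homeoOfEquivCompactToT2 (f :=
    { toFun := fun y => ⟨sphereInv g T y,
        hT.sphereInv_mem_indicatrix hg₁ hg₂ (norm_eq_of_mem_sphere y)⟩
      invFun := fun R => ⟨sphereMap r g T R, by simpa using hT.norm_sphereMap hg₁ hg₂ R.2⟩
      left_inv := fun y =>
        Subtype.ext (hT.sphereMap_sphereInv hg₁ hg₂ (norm_eq_of_mem_sphere y))
      right_inv := fun R => Subtype.ext (hT.sphereInv_sphereMap hg₁ hg₂ R.2) })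
    ((continuous_sphereInv.comp continuous_subtype_val).subtype_mk _)

end IsFrame

end Inverse

/-! ### Charts of the whole indicatrix -/

section Chart

theorem injective_fderiv_of_comp_eq {V F W : Type*} [NormedAddCommGroup V] [NormedSpace ℝ V]
    [NormedAddCommGroup F] [NormedSpace ℝ F] [NormedAddCommGroup W] [NormedSpace ℝ W]
    {f : F → W} {S : V → F} {L : V →L[ℝ] W} {u : V} (hf : DifferentiableAt ℝ f (S u))
    (hS : DifferentiableAt ℝ S u) (hL : Function.Injective L) (h : f ∘ S =ᶠ[nhds u] L) :
    Function.Injective (fderiv ℝ S u) := by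
  have h1 := (hf.hasFDerivAt.comp u hS.hasFDerivAt).fderiv
  rw [h.fderiv_eq, L.fderiv] at h1
  rw [h1] at hL
  exact Function.Injective.of_comp (f := fderiv ℝ f (S u)) hL

variable {n : ℕ} {E : Type*} [NormedAddCommGroup E] [InnerProductSpace ℝ E]
  [Fact (Module.finrank ℝ E = n + 1)]

/-- Inverse stereographic projection, with the coordinate space `Fin n → ℝ`. -/
def stereoParam (v : Metric.sphere (0 : E) 1) (u : Fin n → ℝ) : E :=
  ((stereographic' n v).symm (WithLp.toLp 2 u) : E)

/-- The linear isomorphism from the coordinate space to the equatorial hyperplane. -/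
def stereoPlane (v : Metric.sphere (0 : E) 1) :
    (Fin n → ℝ) ≃L[ℝ] (Submodule.span ℝ {(v : E)})ᗮ :=
  (EuclideanSpace.equiv (Fin n) ℝ).symm.trans
    (OrthonormalBasis.fromOrthogonalSpanSingleton n
      (ne_zero_of_mem_unit_sphere v)).repr.symm.toContinuousLinearEquiv

theorem contDiff_stereoParam (v : Metric.sphere (0 : E) 1) :
    ContDiff ℝ ∞ (stereoParam (n := n) v) :=
  contDiff_stereoInvFunAux.comp
    ((Submodule.subtypeL _).contDiff.comp (stereoPlane (n := n) v).contDiff)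

theorem norm_stereoParam (v : Metric.sphere (0 : E) 1) (u : Fin n → ℝ) :
    ‖stereoParam v u‖ = 1 :=
  norm_eq_of_mem_sphere _

theorem injective_fderiv_stereoParam (v : Metric.sphere (0 : E) 1) (u : Fin n → ℝ) :
    Function.Injective (fderiv ℝ (stereoParam (n := n) v) u) := by
  have hv : ‖(v : E)‖ = 1 := norm_eq_of_mem_sphere v
  have hne : innerSL ℝ (v : E) (stereoParam v u) ≠ 1 := by
    have h1 := stereoInvFun_ne_north_pole hv (stereoPlane v u)
    rw [innerSL_apply_apply, Ne, inner_eq_one_iff_of_norm_eq_one hv (norm_stereoParam v u)]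
    exact fun h => h1 (Subtype.ext h.symm)
  have hopen : IsOpen {x : E | innerSL ℝ (v : E) x ≠ 1} :=
    isOpen_ne_fun (innerSL ℝ (v : E)).continuous continuous_const
  refine injective_fderiv_of_comp_eq (f := stereoToFun (v : E))
    (L := (stereoPlane (n := n) v : (Fin n → ℝ) →L[ℝ] _))
    ((contDiffOn_stereoToFun (n := ∞)).contDiffAt (hopen.mem_nhds hne) |>.differentiableAt
      (by simp))
    ((contDiff_stereoParam v).differentiable (by simp) u) (stereoPlane v).injective
    (Filter.Eventually.of_forall fun w => ?_)
  exact stereo_right_inv hv (stereoPlane v w)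

theorem isSpherical_stereoParam (v : Metric.sphere (0 : E) 1) {c : ℝ} (hc : c ≠ 0) :
    IsSpherical (fun u : Fin n → ℝ => c⁻¹ • stereoParam v u) (c ^ 2) Set.univ where
  isOpen := isOpen_univ
  smooth := (contDiff_const.smul (contDiff_stereoParam v)).contDiffOn
  mem_sphere u _ := by
    rw [real_inner_smul_left, real_inner_smul_right, real_inner_self_eq_norm_sq,
      norm_stereoParam]
    field_simp
  immersion u _ := by
    have h1 := (((contDiff_stereoParam v).differentiable (by simp) u).hasFDerivAt.const_smul
      c⁻¹).fderiv
    rw [show (fun u : Fin n → ℝ => c⁻¹ • stereoParam v u) = c⁻¹ • stereoParam v from rfl, h1]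
    exact (smul_right_injective E (inv_ne_zero hc)).comp (injective_fderiv_stereoParam v u)

variable {r : Matrix (Fin n) (Fin n) ℝ} {g : ℝ} {T : (Fin (n + 1) → ℝ) ≃L[ℝ] E}

/-- Around every point of the indicatrix, stereographic projection of the corresponding sphere of
radius `1/h` provides a chart in which the metric is smooth across the axis. -/
theorem IsFrame.exists_isMetricChart [FiniteDimensional ℝ E] (hg₁ : -2 < g) (hg₂ : g < 2)
    (hr : r.PosDef) (hT : IsFrame r T) (P : indicatrix r g) :
    ∃ (e : OpenPartialHomeomorph (indicatrix r g) (Fin n → ℝ))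
      (γ : (Fin n → ℝ) → Matrix (Fin n) (Fin n) ℝ),
      P ∈ e.source ∧ IsMetricChart r g e γ ∧
        HasConstantCurvatureOn γ (hPar g ^ 2) e.target := by
  have hh := (hPar_pos hg₁ hg₂).ne'
  set H := hT.sphereHomeomorph hg₁ hg₂ with hH
  set v : Metric.sphere (0 : E) 1 := -H.symm P with hv
  set e : OpenPartialHomeomorph (indicatrix r g) (Fin n → ℝ) :=
    H.symm.toOpenPartialHomeomorph.trans ((stereographic' n v).trans
      (EuclideanSpace.equiv (Fin n) ℝ).toHomeomorph.toOpenPartialHomeomorph) with he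
  have hsource : P ∈ e.source := by
    have : H.symm P ≠ v := fun h => ne_neg_of_mem_unit_sphere ℝ (H.symm P) (h.trans hv)
    simpa [he] using this
  have htarget : e.target = Set.univ := by simp [he]
  have hsymm : ∀ u, (e.symm u : Fin (n + 1) → ℝ) = sphereInv g T (stereoParam v u) :=
    fun u => rfl
  have hsph := isSpherical_stereoParam (n := n) v hh
  have hmap : ∀ u, sphereMap r g T (e.symm u) = stereoParam v u := fun u => by
    rw [hsymm, hT.sphereMap_sphereInv hg₁ hg₂ (norm_stereoParam v u)]
  have hcont : Continuous fun u => (e.symm u : Fin (n + 1) → ℝ) := by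
    simp only [hsymm]
    exact continuous_sphereInv.comp (contDiff_stereoParam v).continuous
  have hparam : IsParametrization r g (fun u => (e.symm u : Fin (n + 1) → ℝ))
      {u ∈ e.target | (e.symm u : Fin (n + 1) → ℝ) ∈ regularSet r g} :=
    { isOpen := e.open_target.inter (hT.isOpen_preimage_regularSet hcont)
      smooth := fun u hu => by
        have hu2 := hu.2
        simp only [hsymm] at hu2 ⊢
        exact ((hT.contDiffAt_sphereInv hg₁ hg₂ (norm_stereoParam v u) hu2).comp u
          (contDiff_stereoParam v).contDiffAt).contDiffWithinAt
      mem_indicatrix := fun u _ => (e.symm u).2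
      mem_regular := fun u hu => hu.2
      immersion := fun u hu => by
        have hu2 := hu.2
        -- `sphereMap` is a left inverse up to the immersion `stereoParam`
        have h1 : DifferentiableAt ℝ (sphereMap r g T) (e.symm u : Fin (n + 1) → ℝ) :=
          (hT.contDiffAt_sphereMap hg₁ hg₂ hu2).differentiableAt (by simp)
        have h2 : DifferentiableAt ℝ (fun u => (e.symm u : Fin (n + 1) → ℝ)) u := by
          simp only [hsymm] at hu2 ⊢
          exact ((hT.contDiffAt_sphereInv hg₁ hg₂ (norm_stereoParam v u) hu2).comp u
            (contDiff_stereoParam v).contDiffAt).differentiableAt (by simp)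
        have h3 := (h1.hasFDerivAt.comp u h2.hasFDerivAt).fderiv
        have h4 : sphereMap r g T ∘ (fun u => (e.symm u : Fin (n + 1) → ℝ)) = stereoParam v :=
          funext hmap
        rw [h4] at h3
        have h5 := injective_fderiv_stereoParam (n := n) v u
        rw [h3] at h5
        exact Function.Injective.of_comp h5 }
  refine ⟨e, firstForm fun u => (hPar g)⁻¹ • stereoParam v u, hsource, ?_, ?_⟩
  · refine ⟨fun i j => ?_, fun u _ => posDef_firstForm (hsph.immersion u trivial), hparam,
      fun u hu hreg => ?_⟩
    · rw [htarget]
      exact contDiffOn_firstForm isOpen_univ hsph.smooth i j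
    · rw [hparam.inducedMetric_eq hg₁ hg₂ hr hT ⟨hu, hreg⟩]
      simp only [hmap]
  · rw [htarget]
    exact hsph.hasConstantCurvatureOn Fact.out

end Chart

end

end Finsleroid

theorem theorem2p3 {n : ℕ} (r : Matrix (Fin n) (Fin n) ℝ) (hr : r.PosDef)
    (g : ℝ) (hg₁ : -2 < g) (hg₂ : g < 2) :
    -- the curvature tensor `S`, together with the facts that make it meaningful
    (∀ R ∈ Finsleroid.regularSet r g,
      ContDiffAt ℝ ∞ (Finsleroid.K r g) R ∧ 0 < Finsleroid.K r g R ∧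
      (Finsleroid.metric r g R).PosDef ∧
      ∀ a b c d : Fin (n + 1),
        Finsleroid.curvatureS r g a b c d R =
          -(g ^ 2 / 4) *
            (Finsleroid.angular r g a c R * Finsleroid.angular r g b d R
              - Finsleroid.angular r g a d R * Finsleroid.angular r g b c R)
            / Finsleroid.K r g R ^ 2) ∧
    -- the constant is positive
    Finsleroid.hPar g ^ 2 = 1 - g ^ 2 / 4 ∧ 0 < Finsleroid.hPar g ^ 2 ∧
    -- in every smooth parametrization the induced metric has constant curvature `h²`
    (∀ (φ : (Fin n → ℝ) → (Fin (n + 1) → ℝ)) (U : Set (Fin n → ℝ)),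
      Finsleroid.IsParametrization r g φ U →
      Finsleroid.HasConstantCurvatureOn (Finsleroid.inducedMetric r g φ)
        (Finsleroid.hPar g ^ 2) U) ∧
    -- the whole indicatrix, axis points included, is covered by charts in which the metric is
    -- smooth and has constant curvature `h²`
    (∀ P : Finsleroid.indicatrix r g,
      ∃ (e : OpenPartialHomeomorph (Finsleroid.indicatrix r g) (Fin n → ℝ))
        (γ : (Fin n → ℝ) → Matrix (Fin n) (Fin n) ℝ),
        P ∈ e.source ∧ Finsleroid.IsMetricChart r g e γ ∧
        Finsleroid.HasConstantCurvatureOn γ (Finsleroid.hPar g ^ 2) e.target) := by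
  obtain ⟨T, hT⟩ := Finsleroid.exists_isFrame hr
  have hfin : Module.finrank ℝ (EuclideanSpace ℝ (Fin (n + 1))) = n + 1 := by simp
  have : Fact (Module.finrank ℝ (EuclideanSpace ℝ (Fin (n + 1))) = n + 1) := ⟨hfin⟩
  refine ⟨fun R hR => ⟨hT.contDiffAt_K hg₁ hg₂ hr hR, hT.K_pos hg₁ hg₂ hr hR,
    hT.metric_posDef hg₁ hg₂ hr hR, hT.curvatureS_eq hg₁ hg₂ hr hR⟩,
    Finsleroid.hPar_sq hg₁ hg₂, pow_pos (Finsleroid.hPar_pos hg₁ hg₂) 2, fun φ U hφ => ?_,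
    hT.exists_isMetricChart hg₁ hg₂ hr⟩
  exact ((hφ.isSpherical hg₁ hg₂ hr hT).hasConstantCurvatureOn hfin).congr hφ.isOpen
    fun u hu => hφ.inducedMetric_eq hg₁ hg₂ hr hT hu
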